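/- A quantum channel is a completely positive trace-preserving linear map between matrix algebras $M_d(\mathbb C)\to M_{d'}(\mathbb C)$, and an effect is a matrix $\Omega_0$ with $0\le\Omega_0\le 1$. Let $\Phi_0,\Phi_1$ be quantum channels with common input dimension $d$ and common output dimension $d'$, let $N\ge 1$ be an integer and $\varepsilon$ a real number. *Parallel scheme.* We say that $\Phi_0$ is $\varepsilon$-certified against $\Phi_1$ by $N$ parallel uses if there are a finite-dimensional ancilla, a unit vector $|\psi\rangle$ in $(\mathbb C^d)^{\otimes N}\otimes\text{ancilla}$ and an effect $\Omega_0$ such that, with $\sigma_i=(\Phi_i^{\otimes N}\otimes\mathrm{id})(|\psi\rangle\langle\psi|)$, the false negative probability $\operatorname{Tr}(\Omega_0\sigma_1)$ equals $0$ and the false positive probability $\operatorname{Tr}((1-\Omega_0)\sigma_0)$ is at most $\varepsilon$. *Adaptive scheme.* We say that $\Phi_0$ is $\varepsilon$-certified against $\Phi_1$ by $N$ adaptive uses if there are finite-dimensional memories $R_0,\dots,R_{N-1}$, a unit vector $|\psi\rangle\in\mathbb C^d\otimes R_0$, processing channels $\Xi_n$ from operators on $\mathbb C^{d'}\otimes R_{n-1}$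 to operators on $\mathbb C^{d}\otimes R_{n}$ ($1\le n\le N-1$), and an effect $\Omega_0$ on $\mathbb C^{d'}\otimes R_{N-1}$ such that, with $$\tau_i=(\Phi_i\otimes\mathrm{id})\circ\Xi_{N-1}\circ(\Phi_i\otimes\mathrm{id})\circ\cdots\circ\Xi_1\circ(\Phi_i\otimes\mathrm{id})\,(|\psi\rangle\langle\psi|),$$ $\operatorname{Tr}(\Omega_0\tau_1)=0$ and $\operatorname{Tr}((1-\Omega_0)\tau_0)\le\varepsilon$. $\Phi_0$ *can be certified against* $\Phi_1$ in the parallel (adaptive) scheme if for every $\varepsilon>0$ there is $N\ge 1$ such that $\Phi_0$ is $\varepsilon$-certified against $\Phi_1$ by $N$ parallel (adaptive) uses. **Theorem.** 1. For all quantum channels $\Phi_0,\Phi_1$ with the same input and the same output dimension, $\Phi_0$ can be certified against $\Phi_1$ in the parallel scheme if and only if it can be certified against $\Phi_1$ in the adaptive scheme. Moreover, whenever, for some $N\ge1$ and some $\varepsilon<1$, $\Phi_0$ is $\varepsilon$-certified against $\Phi_1$ by $N$ adaptive uses (so that false negatives are excluded with finitely many uses and a false positive is not certain), $\Phi_0$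 can be certified against $\Phi_1$ in the parallel scheme. 2. The adaptive scheme may need fewer uses: there are quantum channels $\Phi_0,\Phi_1$ such that $\Phi_0$ can be certified against $\Phi_1$ in the parallel scheme, and an $\varepsilon>0$ for which the minimal number of uses needed for $\varepsilon$-certification in the adaptive scheme is strictly smaller than the minimal number needed in the parallel scheme. -/

import Mathlib

open Matrix
open scoped ComplexOrder

/-- `Φ ⊗ id`: the map `Φ` applied to the first tensor factor, the identity on the ancilla `r`. -/
def tensorId {a b : Type*} (r : Type*) (Φ : Matrix a a ℂ →ₗ[ℂ] Matrix b b ℂ) :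
    Matrix (a × r) (a × r) ℂ →ₗ[ℂ] Matrix (b × r) (b × r) ℂ where
  toFun X := Matrix.of fun p q =>
    Φ (Matrix.of fun i j => X (i, p.2) (j, q.2)) p.1 q.1
  map_add' X Y := by
    ext p q
    exact congrFun (congrFun (Φ.map_add (Matrix.of fun i j => X (i, p.2) (j, q.2))
      (Matrix.of fun i j => Y (i, p.2) (j, q.2))) p.1) q.1
  map_smul' c X := by
    ext p q
    exact congrFun (congrFun (Φ.map_smul c (Matrix.of fun i j => X (i, p.2) (j, q.2))) p.1) q.1

/-- `(Φ ⊗ id)(A ⊗ B) = Φ(A) ⊗ B`. -/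
theorem tensorId_kronecker {a b r : Type*} (Φ : Matrix a a ℂ →ₗ[ℂ] Matrix b b ℂ)
    (A : Matrix a a ℂ) (B : Matrix r r ℂ) :
    tensorId r Φ (Matrix.kroneckerMap (· * ·) A B) =
      Matrix.kroneckerMap (· * ·) (Φ A) B := by
  ext p q
  have h : (Matrix.of fun i j => Matrix.kroneckerMap (· * ·) A B (i, p.2) (j, q.2))
      = B p.2 q.2 • A := by
    ext i j
    simp [mul_comm]
  change Φ (Matrix.of fun i j => Matrix.kroneckerMap (· * ·) A B (i, p.2) (j, q.2)) p.1 q.1 = _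
  rw [h, map_smul]
  simp [mul_comm]

/-- The `N`-fold tensor power `Φ^{⊗N}`: the linear extension of
`⊗ₙ |kₙ⟩⟨lₙ| ↦ ⊗ₙ Φ(|kₙ⟩⟨lₙ|)` from matrix units. The space `(ℂ^a)^{⊗N}` has the basis
indexed by `Fin N → a`. -/
def tensorPower {a b : Type*} [Fintype a] [DecidableEq a] (N : ℕ)
    (Φ : Matrix a a ℂ →ₗ[ℂ] Matrix b b ℂ) :
    Matrix (Fin N → a) (Fin N → a) ℂ →ₗ[ℂ] Matrix (Fin N → b) (Fin N → b) ℂ where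
  toFun X := Matrix.of fun p q =>
    ∑ k : Fin N → a, ∑ l : Fin N → a,
      X k l * ∏ n, Φ (Matrix.single (k n) (l n) 1) (p n) (q n)
  map_add' X Y := by
    ext p q
    simp [add_mul, Finset.sum_add_distrib]
  map_smul' c X := by
    ext p q
    simp [Finset.mul_sum, mul_assoc]

/-- `Φ^{⊗N}(X₁ ⊗ ⋯ ⊗ X_N) = Φ(X₁) ⊗ ⋯ ⊗ Φ(X_N)`. -/
theorem tensorPower_prod {a b : Type*} [Fintype a] [DecidableEq a] (N : ℕ)
    (Φ : Matrix a a ℂ →ₗ[ℂ] Matrix b b ℂ) (X : Fin N → Matrix a a ℂ) :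
    tensorPower N Φ (Matrix.of fun k l => ∏ n, X n (k n) (l n)) =
      Matrix.of fun p q => ∏ n, Φ (X n) (p n) (q n) := by
  have key : ∀ (A : Matrix a a ℂ) (i j : b),
      Φ A i j = ∑ k, ∑ l, A k l * Φ (Matrix.single k l 1) i j := by
    intro A i j
    conv_lhs => rw [Matrix.matrix_eq_sum_single A]
    simp only [map_sum, Matrix.sum_apply]
    refine Finset.sum_congr rfl fun k _ => Finset.sum_congr rfl fun l _ => ?_
    have h : Matrix.single k l (A k l) = A k l • Matrix.single k l (1 : ℂ) := by
      simp [Matrix.smul_single]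
    rw [h, map_smul]
    simp
  ext p q
  change (∑ k : Fin N → a, ∑ l : Fin N → a, (∏ n, X n (k n) (l n)) *
    ∏ n, Φ (Matrix.single (k n) (l n) 1) (p n) (q n)) = ∏ n, Φ (X n) (p n) (q n)
  simp_rw [key (X _), ← Finset.prod_mul_distrib]
  rw [Fintype.prod_sum]
  refine Finset.sum_congr rfl fun k _ => ?_
  rw [Fintype.prod_sum]

/-- A quantum channel: a completely positive and trace preserving linear map. -/
structure IsQuantumChannel {a b : Type*} [Fintype a] [Fintype b]
    (Φ : Matrix a a ℂ →ₗ[ℂ] Matrix b b ℂ) : Prop where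
  completelyPositive : ∀ (k : ℕ) (X : Matrix (a × Fin k) (a × Fin k) ℂ),
    X.PosSemidef → (tensorId (Fin k) Φ X).PosSemidef
  tracePreserving : ∀ X : Matrix a a ℂ, (Φ X).trace = X.trace

/-- `ψ` is a unit vector. -/
def IsPureState {s : Type*} [Fintype s] (ψ : s → ℂ) : Prop :=
  ∑ i, ‖ψ i‖ ^ 2 = 1

/-- The projection `|ψ⟩⟨ψ|`. -/
def ketbra {s : Type*} (ψ : s → ℂ) : Matrix s s ℂ :=
  Matrix.vecMulVec ψ (star ψ)

/-- `Ω₀` is an effect of a binary measurement `{Ω₀, 1 - Ω₀}`. -/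
def IsEffect {s : Type*} [Fintype s] [DecidableEq s] (Ω₀ : Matrix s s ℂ) : Prop :=
  Ω₀.PosSemidef ∧ (1 - Ω₀).PosSemidef

/-- Probability of the false positive error, `Tr ((1 - Ω₀) ρ₀)`, when the output state under the
null hypothesis is `ρ₀`. -/
def falsePositive {s : Type*} [Fintype s] [DecidableEq s] (Ω₀ ρ₀ : Matrix s s ℂ) : ℝ :=
  ((1 - Ω₀) * ρ₀).trace.re

/-- Probability of the false negative error, `Tr (Ω₀ ρ₁)`, when the output state under the
alternative hypothesis is `ρ₁`. -/
def falseNegative {s : Type*} [Fintype s] (Ω₀ ρ₁ : Matrix s s ℂ) : ℝ :=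
  (Ω₀ * ρ₁).trace.re

/-- The output state `(Φ^{⊗N} ⊗ id)(|ψ⟩⟨ψ|)` of the parallel scheme. -/
def parallelOutput {a b r : Type*} [Fintype a] [DecidableEq a] (N : ℕ)
    (Φ : Matrix a a ℂ →ₗ[ℂ] Matrix b b ℂ) (ψ : (Fin N → a) × r → ℂ) :
    Matrix ((Fin N → b) × r) ((Fin N → b) × r) ℂ :=
  tensorId r (tensorPower N Φ) (ketbra ψ)

/-- With `N ≥ 1` parallel uses of the channel, an input state (entangled with some ancilla `r`) and
a measurement effect exist for which the false negative error has probability zero and the false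
positive error has probability at most `ε`. -/
def ParallelCertifiable {a b : Type*} [Fintype a] [DecidableEq a] [Fintype b] [DecidableEq b]
    (Φ₀ Φ₁ : Matrix a a ℂ →ₗ[ℂ] Matrix b b ℂ) (N : ℕ) (ε : ℝ) : Prop :=
  1 ≤ N ∧ ∃ (r : Type) (_ : Fintype r) (_ : DecidableEq r) (ψ : (Fin N → a) × r → ℂ)
    (Ω₀ : Matrix ((Fin N → b) × r) ((Fin N → b) × r) ℂ),
    IsPureState ψ ∧ IsEffect Ω₀ ∧
    falseNegative Ω₀ (parallelOutput N Φ₁ ψ) = 0 ∧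
    falsePositive Ω₀ (parallelOutput N Φ₀ ψ) ≤ ε

/-- The state after the `(n+1)`-st use of `Φ` in the adaptive scheme with input state `ψ`: the
`(n+1)`-st use is followed by the processing `Ξ n`, which maps the output of the channel together
with the memory `mem n` to the next input together with the memory `mem (n+1)`. -/
def adaptiveOutput {a b : Type*} {mem : ℕ → Type}
    (Φ : Matrix a a ℂ →ₗ[ℂ] Matrix b b ℂ) (ψ : a × mem 0 → ℂ)
    (Ξ : ∀ n, Matrix (b × mem n) (b × mem n) ℂ →ₗ[ℂ]
      Matrix (a × mem (n + 1)) (a × mem (n + 1)) ℂ) :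
    ∀ n, Matrix (b × mem n) (b × mem n) ℂ
  | 0 => tensorId (mem 0) Φ (ketbra ψ)
  | n + 1 => tensorId (mem (n + 1)) Φ (Ξ n (adaptiveOutput Φ ψ Ξ n))

/-- With `N ≥ 1` adaptive uses of the channel, an input state, `N - 1` processing channels between
the uses and a measurement effect after the last use exist (the same ones for both hypotheses) for
which the false negative error has probability zero and the false positive error has probability at
most `ε`. Only `Ξ 0, …, Ξ (N - 2)` enter the state after `N` uses. -/
def AdaptiveCertifiable {a b : Type*} [Fintype a] [Fintype b] [DecidableEq b]
    (Φ₀ Φ₁ : Matrix a a ℂ →ₗ[ℂ] Matrix b b ℂ) (N : ℕ) (ε : ℝ) : Prop :=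
  1 ≤ N ∧ ∃ (mem : ℕ → Type) (_ : ∀ n, Fintype (mem n)) (_ : ∀ n, DecidableEq (mem n))
    (ψ : a × mem 0 → ℂ)
    (Ξ : ∀ n, Matrix (b × mem n) (b × mem n) ℂ →ₗ[ℂ]
      Matrix (a × mem (n + 1)) (a × mem (n + 1)) ℂ)
    (Ω₀ : Matrix (b × mem (N - 1)) (b × mem (N - 1)) ℂ),
    IsPureState ψ ∧ (∀ n, n < N - 1 → IsQuantumChannel (Ξ n)) ∧ IsEffect Ω₀ ∧
    falseNegative Ω₀ (adaptiveOutput Φ₁ ψ Ξ (N - 1)) = 0 ∧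
    falsePositive Ω₀ (adaptiveOutput Φ₀ ψ Ξ (N - 1)) ≤ ε

/-- `Φ₀` can be certified against `Φ₁` in the parallel scheme. -/
def CanBeCertifiedInParallel {a b : Type*} [Fintype a] [DecidableEq a] [Fintype b] [DecidableEq b]
    (Φ₀ Φ₁ : Matrix a a ℂ →ₗ[ℂ] Matrix b b ℂ) : Prop :=
  ∀ ε : ℝ, 0 < ε → ∃ N : ℕ, ParallelCertifiable Φ₀ Φ₁ N ε

/-- `Φ₀` can be certified against `Φ₁` in the adaptive scheme. -/
def CanBeCertifiedAdaptively {a b : Type*} [Fintype a] [Fintype b] [DecidableEq b]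
    (Φ₀ Φ₁ : Matrix a a ℂ →ₗ[ℂ] Matrix b b ℂ) : Prop :=
  ∀ ε : ℝ, 0 < ε → ∃ N : ℕ, AdaptiveCertifiable Φ₀ Φ₁ N ε

/-- `N` is the minimal number of steps needed for parallel certification at level `ε`. -/
def IsMinParallelSteps {a b : Type*} [Fintype a] [DecidableEq a] [Fintype b] [DecidableEq b]
    (Φ₀ Φ₁ : Matrix a a ℂ →ₗ[ℂ] Matrix b b ℂ) (ε : ℝ) (N : ℕ) : Prop :=
  IsLeast {M : ℕ | ParallelCertifiable Φ₀ Φ₁ M ε} N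

/-- `N` is the minimal number of steps needed for adaptive certification at level `ε`. -/
def IsMinAdaptiveSteps {a b : Type*} [Fintype a] [Fintype b] [DecidableEq b]
    (Φ₀ Φ₁ : Matrix a a ℂ →ₗ[ℂ] Matrix b b ℂ) (ε : ℝ) (N : ℕ) : Prop :=
  IsLeast {M : ℕ | AdaptiveCertifiable Φ₀ Φ₁ M ε} N

/-! Both schemes are governed by one condition: is the Choi matrix of Φ₀ bounded by a multiple c of
the Choi matrix of Φ₁?

If it is, every use of the channel costs at most a factor c, so after N uses of either scheme the
output states satisfy σ₀ ≤ c^N σ₁. An effect that vanishes on σ₁ then vanishes on σ₀, and the false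
positive has probability 1 (`ChoiDominated.one_le_of_parallelCertifiable`,
`ChoiDominated.one_le_of_adaptiveCertifiable`).

If it is not, some unit vector v in the kernel of the Choi matrix of Φ₁ is seen by that of Φ₀
(`dominated_or_exists_vector`). Sending half of a maximally entangled state and testing against v
always accepts Φ₁ and accepts Φ₀ with some probability q < 1. Repeating the test, in parallel or one
use at a time, leaves a false positive of probability q^N.

For the gap, the example channels hide a key: input |2⟩ yields a state which, fed back, makes the
two answers orthogonal, so two adaptive uses are perfect. Parallel uses cannot feed the key back. If
some combination of the overlaps Eᵢ† Fⱼ of Kraus operators is at least 1, so is its N-th tensor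
power; hence for every input the output mixtures have non-negligible overlap, and without false
negatives the false positive is bounded below for each fixed N (`exists_le_of_parallelCertifiable`).
A level below the bounds for N = 1 and N = 2 separates the schemes. -/

/-! ### Choi matrices and complete positivity -/

/-- The Choi matrix of a linear map between matrix algebras. -/
def choi {a b : Type*} [DecidableEq a] (Φ : Matrix a a ℂ →ₗ[ℂ] Matrix b b ℂ) :
    Matrix (b × a) (b × a) ℂ :=
  Matrix.of fun p q => Φ (Matrix.single p.2 q.2 1) p.1 q.1

theorem map_apply_eq_sum_choi {a b : Type*} [Fintype a] [DecidableEq a]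
    (Φ : Matrix a a ℂ →ₗ[ℂ] Matrix b b ℂ) (A : Matrix a a ℂ) (i j : b) :
    Φ A i j = ∑ k, ∑ l, A k l * choi Φ (i, k) (j, l) := by
  conv_lhs => rw [Matrix.matrix_eq_sum_single A]
  simp only [map_sum, Matrix.sum_apply]
  refine Finset.sum_congr rfl fun k _ => Finset.sum_congr rfl fun l _ => ?_
  have h : Matrix.single k l (A k l) = A k l • Matrix.single k l (1 : ℂ) := by
    simp [Matrix.smul_single]
  rw [h, map_smul]
  simp [choi]

/-- The contraction is B M B†, where B sums over the second index. -/
theorem posSemidef_contract {a β : Type*} [Fintype a] [Fintype β]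
    {M : Matrix (β × a) (β × a) ℂ} (hM : M.PosSemidef) :
    (Matrix.of fun p q => ∑ k, ∑ l, M (p, k) (q, l)).PosSemidef := by
  classical
  let B : Matrix β (β × a) ℂ := Matrix.of fun p x => if p = x.1 then 1 else 0
  have h (x : β × a) (p : β) : (B * M) p x = ∑ k, M (p, k) x := by
    simp only [Matrix.mul_apply, B, Matrix.of_apply, Fintype.sum_prod_type, ite_mul, one_mul,
      zero_mul]
    rw [Finset.sum_comm]
    simp
  convert hM.mul_mul_conjTranspose_same B using 1
  ext p q
  rw [Matrix.mul_apply, Fintype.sum_prod_type, Finset.sum_comm]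
  simp only [h, B, Matrix.of_apply, Matrix.conjTranspose_apply, apply_ite star, star_one,
    star_zero, mul_ite, mul_one, mul_zero, Finset.sum_ite_eq, Finset.mem_univ, if_true]
  exact Finset.sum_comm

/-- A map with positive semidefinite Choi matrix is completely positive. -/
theorem posSemidef_tensorId {a b r : Type*} [Fintype a] [DecidableEq a] [Fintype b] [Fintype r]
    {Φ : Matrix a a ℂ →ₗ[ℂ] Matrix b b ℂ} (hΦ : (choi Φ).PosSemidef)
    {X : Matrix (a × r) (a × r) ℂ} (hX : X.PosSemidef) : (tensorId r Φ X).PosSemidef := by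
  classical
  -- The output is the Schur product of the input and the Choi matrix, contracted over the input
  -- index of Φ.
  have h := posSemidef_contract (a := a) (β := b × r)
    ((hX.submatrix fun x : (b × r) × a => (x.2, x.1.2)).hadamard
      (hΦ.submatrix fun x : (b × r) × a => (x.1.1, x.2)))
  convert h using 1
  ext p q
  change Φ (Matrix.of fun i j => X (i, p.2) (j, q.2)) p.1 q.1 = _
  rw [map_apply_eq_sum_choi]
  rfl

theorem posSemidef_ketbra {s : Type*} [Fintype s] (ψ : s → ℂ) : (ketbra ψ).PosSemidef :=
  posSemidef_vecMulVec_self_star ψ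

theorem trace_ketbra {s : Type*} [Fintype s] {ψ : s → ℂ} (h : IsPureState ψ) :
    (ketbra ψ).trace = 1 := by
  have : ((∑ i, ‖ψ i‖ ^ 2 : ℝ) : ℂ) = 1 := by rw [h]; simp
  rw [← this]
  simp [ketbra, Matrix.trace, vecMulVec_apply, Complex.mul_conj, Complex.normSq_eq_norm_sq]

theorem choi_eq_tensorId {a b : Type*} [Fintype a] [DecidableEq a]
    (Φ : Matrix a a ℂ →ₗ[ℂ] Matrix b b ℂ) :
    choi Φ = tensorId a Φ (ketbra fun x => if x.1 = x.2 then 1 else 0) := by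
  ext p q
  change Φ _ p.1 q.1 = Φ _ p.1 q.1
  refine congrArg (fun Y => Φ Y p.1 q.1) ?_
  ext i j
  simp [ketbra, vecMulVec_apply, Matrix.single_apply, ← ite_and, eq_comm, and_comm]

/-- The ancilla is a copy of the input space. Complete positivity is only assumed for ancillas `Fin
k`, hence the input index `Fin d`. -/
theorem IsQuantumChannel.posSemidef_choi {b : Type*} [Fintype b] {d : ℕ}
    {Φ : Matrix (Fin d) (Fin d) ℂ →ₗ[ℂ] Matrix b b ℂ} (h : IsQuantumChannel Φ) :
    (choi Φ).PosSemidef := by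
  rw [choi_eq_tensorId]
  exact h.completelyPositive d _ (posSemidef_ketbra _)

theorem IsQuantumChannel.of_choi {a b : Type*} [Fintype a] [DecidableEq a] [Fintype b]
    {Φ : Matrix a a ℂ →ₗ[ℂ] Matrix b b ℂ} (h : (choi Φ).PosSemidef)
    (htr : ∀ X, (Φ X).trace = X.trace) : IsQuantumChannel Φ :=
  ⟨fun _ _ hX => posSemidef_tensorId h hX, htr⟩

theorem IsQuantumChannel.posSemidef {a b : Type*} [Fintype a] [Fintype b]
    {Φ : Matrix a a ℂ →ₗ[ℂ] Matrix b b ℂ} (h : IsQuantumChannel Φ) {X : Matrix a a ℂ}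
    (hX : X.PosSemidef) : (Φ X).PosSemidef :=
  (h.completelyPositive 1 _ (hX.submatrix Prod.fst)).submatrix fun i => (i, 0)

theorem trace_tensorId {a b r : Type*} [Fintype a] [Fintype b] [Fintype r]
    {Φ : Matrix a a ℂ →ₗ[ℂ] Matrix b b ℂ} (htr : ∀ X, (Φ X).trace = X.trace)
    (X : Matrix (a × r) (a × r) ℂ) : (tensorId r Φ X).trace = X.trace := by
  simp only [Matrix.trace, Matrix.diag, Fintype.sum_prod_type_right]
  exact Finset.sum_congr rfl fun s _ => htr (Matrix.of fun i j => X (i, s) (j, s))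

theorem tensorId_smul_sub {a b r : Type*} (c : ℂ) (Φ Ψ : Matrix a a ℂ →ₗ[ℂ] Matrix b b ℂ)
    (X : Matrix (a × r) (a × r) ℂ) :
    tensorId r (c • Φ - Ψ) X = c • tensorId r Φ X - tensorId r Ψ X := rfl

theorem choi_smul_sub {a b : Type*} [DecidableEq a] (c : ℂ)
    (Φ Ψ : Matrix a a ℂ →ₗ[ℂ] Matrix b b ℂ) : choi (c • Φ - Ψ) = c • choi Φ - choi Ψ := rfl

/-! ### Domination of states and errors -/

theorem trace_mul_ketbra {s : Type*} [Fintype s] (A : Matrix s s ℂ) (v : s → ℂ) :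
    (A * ketbra v).trace = star v ⬝ᵥ (A *ᵥ v) := by
  rw [ketbra, mul_vecMulVec, trace_vecMulVec, dotProduct_comm]

theorem Matrix.PosSemidef.trace_mul_nonneg {s : Type*} [Fintype s] {A B : Matrix s s ℂ}
    (hA : A.PosSemidef) (hB : B.PosSemidef) : 0 ≤ (A * B).trace := by
  obtain ⟨m, v, rfl⟩ := posSemidef_iff_eq_sum_vecMulVec.1 hB
  rw [Finset.mul_sum, trace_sum]
  refine Finset.sum_nonneg fun i _ => ?_
  change 0 ≤ (A * ketbra (v i)).trace
  rw [trace_mul_ketbra]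
  exact hA.dotProduct_mulVec_nonneg _

/-- If `σ₀ ≤ c σ₁` and `Ω` has expectation zero on `σ₁` then also on `σ₀`. -/
theorem trace_mul_re_eq_zero_of_dominated {s : Type*} [Fintype s] {Ω σ₀ σ₁ : Matrix s s ℂ} {c : ℂ}
    (hΩ : Ω.PosSemidef) (h₀ : σ₀.PosSemidef) (h₁ : σ₁.PosSemidef) (h : (c • σ₁ - σ₀).PosSemidef)
    (hz : (Ω * σ₁).trace.re = 0) : (Ω * σ₀).trace.re = 0 := by
  have e : (Ω * σ₁).trace = 0 := Complex.ext hz (Complex.nonneg_iff.1 (hΩ.trace_mul_nonneg h₁)).2.symm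
  have h2 := hΩ.trace_mul_nonneg h
  rw [mul_sub, mul_smul_comm, trace_sub, trace_smul, e, smul_zero, zero_sub] at h2
  have h3 := (Complex.nonneg_iff.1 h2).1
  have h4 := (Complex.nonneg_iff.1 (hΩ.trace_mul_nonneg h₀)).1
  simp only [Complex.neg_re] at h3
  linarith

theorem falsePositive_eq_one_of_dominated {s : Type*} [Fintype s] [DecidableEq s]
    {Ω σ₀ σ₁ : Matrix s s ℂ} {c : ℂ} (hΩ : Ω.PosSemidef) (h₀ : σ₀.PosSemidef)
    (h₁ : σ₁.PosSemidef) (htr : σ₀.trace = 1) (h : (c • σ₁ - σ₀).PosSemidef)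
    (hz : falseNegative Ω σ₁ = 0) : falsePositive Ω σ₀ = 1 := by
  have := trace_mul_re_eq_zero_of_dominated hΩ h₀ h₁ h hz
  rw [falsePositive, sub_mul, one_mul, trace_sub, htr, Complex.sub_re, this]
  simp

/-! ### Pinching and the domination alternative -/

/-- This is the Cauchy–Schwarz bound |∑ xᵢ|² ≤ n ∑ |xᵢ|². -/
theorem posSemidef_card_smul_one_sub_ones (s : Type*) [Fintype s] [DecidableEq s] :
    ((Fintype.card s : ℂ) • (1 : Matrix s s ℂ) - Matrix.of fun _ _ => 1).PosSemidef := by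
  refine .of_dotProduct_mulVec_nonneg ?_ fun x => ?_
  · ext i j
    by_cases h : i = j <;> simp [h, Ne.symm]
  have h : star x ⬝ᵥ (((Fintype.card s : ℂ) • (1 : Matrix s s ℂ) - Matrix.of fun _ _ => 1) *ᵥ x) =
      ((Fintype.card s * ∑ i, ‖x i‖ ^ 2 - ‖∑ i, x i‖ ^ 2 : ℝ) : ℂ) := by
    push_cast
    rw [sub_mulVec, dotProduct_sub, smul_mulVec, one_mulVec, dotProduct_smul]
    congr 1
    · simp [dotProduct, ← Complex.normSq_eq_conj_mul_self, Complex.normSq_eq_norm_sq]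
    · rw [← Complex.ofReal_pow, ← Complex.normSq_eq_norm_sq, Complex.normSq_eq_conj_mul_self]
      simp [dotProduct, mulVec, Finset.sum_mul]
  rw [h, Complex.zero_le_real, sub_nonneg]
  calc ‖∑ i, x i‖ ^ 2 ≤ (∑ i, ‖x i‖) ^ 2 := by gcongr; exact norm_sum_le _ _
    _ ≤ _ := by simpa using sq_sum_le_card_mul_sum_sq (s := Finset.univ) (f := fun i => ‖x i‖)

/-- The pinching inequality `M ≤ n · diag M`. -/
theorem Matrix.PosSemidef.pinching {s : Type*} [Fintype s] [DecidableEq s] {M : Matrix s s ℂ}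
    (hM : M.PosSemidef) :
    ((Fintype.card s : ℂ) • diagonal (fun i => M i i) - M).PosSemidef := by
  have e : (Fintype.card s : ℂ) • diagonal (fun i => M i i) - M =
      M ⊙ ((Fintype.card s : ℂ) • (1 : Matrix s s ℂ) - Matrix.of fun _ _ => 1) := by
    ext i j
    by_cases h : i = j
    · subst h; simp [mul_sub, mul_comm]
    · simp [h]
  rw [e]
  exact hM.hadamard (posSemidef_card_smul_one_sub_ones s)

/-- Either `A ≤ c B` for some constant `c`, or a unit vector in the kernel of `B` sees `A`. -/
theorem dominated_or_exists_vector {s : Type*} [Fintype s] [DecidableEq s] {A B : Matrix s s ℂ}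
    (hA : A.PosSemidef) (hB : B.PosSemidef) :
    (∃ c : ℝ, 0 ≤ c ∧ ((c : ℂ) • B - A).PosSemidef) ∨
      ∃ v : s → ℂ, IsPureState v ∧ star v ⬝ᵥ (B *ᵥ v) = 0 ∧ 0 < star v ⬝ᵥ (A *ᵥ v) := by
  set U : Matrix s s ℂ := (hB.1.eigenvectorUnitary : Matrix s s ℂ) with hU
  set l := hB.1.eigenvalues with hl
  have hUU : Uᴴ * U = 1 := (Matrix.mem_unitaryGroup_iff'.1 hB.1.eigenvectorUnitary.2)
  have hUU' : U * Uᴴ = 1 := (Matrix.mem_unitaryGroup_iff.1 hB.1.eigenvectorUnitary.2)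
  have hl0 : ∀ i, 0 ≤ l i := hB.eigenvalues_nonneg
  have hBd : B = U * diagonal (fun i => (l i : ℂ)) * Uᴴ := by
    conv_lhs => rw [hB.1.spectral_theorem]
    rfl
  set M := Uᴴ * A * U with hMdef
  have hM : M.PosSemidef := hA.conjTranspose_mul_mul_same U
  have hAM : A = U * M * Uᴴ := by
    rw [hMdef, ← mul_assoc, ← mul_assoc, hUU', one_mul, mul_assoc, hUU', mul_one]
  have entry : ∀ (C : Matrix s s ℂ) (i : s), star (fun j => U j i) ⬝ᵥ (C *ᵥ fun j => U j i) =
      (Uᴴ * C * U) i i := by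
    intro C i
    rw [mul_assoc, Matrix.mul_apply]
    rfl
  -- In an eigenbasis of B, with M the matrix of A, either a null eigenvector of B has a nonzero
  -- diagonal entry in M and is the required vector, or all these entries vanish.
  by_cases h : ∃ i, l i = 0 ∧ M i i ≠ 0
  · right
    obtain ⟨i, hi, hMi⟩ := h
    refine ⟨fun j => U j i, ?_, ?_, ?_⟩
    · have h1 := congrFun (congrFun hUU i) i
      rw [Matrix.mul_apply] at h1
      have h2 : ((∑ j, ‖U j i‖ ^ 2 : ℝ) : ℂ) = 1 := by
        rw [Matrix.one_apply_eq] at h1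
        rw [← h1]
        simp [← Complex.normSq_eq_conj_mul_self, Complex.normSq_eq_norm_sq]
      exact_mod_cast h2
    · rw [entry, hBd]
      have : Uᴴ * (U * diagonal (fun i => (l i : ℂ)) * Uᴴ) * U = diagonal (fun i => (l i : ℂ)) := by
        rw [← mul_assoc, ← mul_assoc, hUU, one_mul, mul_assoc, hUU, mul_one]
      rw [this, diagonal_apply_eq, hi, Complex.ofReal_zero]
    · rw [entry]
      exact lt_of_le_of_ne hM.diag_nonneg (Ne.symm hMi)
  · left
    push Not at h
    let n : ℝ := Fintype.card s
    -- The constant makes c lᵢ ≥ n Mᵢᵢ for every i, so that c B dominates the pinching bound n ·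
    -- diag M ≥ M. Null eigenvalues contribute 0, since division by zero gives zero.
    refine ⟨∑ i, n * (M i i).re / l i, Finset.sum_nonneg fun i _ => ?_, ?_⟩
    · have := (Complex.nonneg_iff.1 (hM.diag_nonneg (i := i))).1
      have := hl0 i
      positivity
    set c := ∑ i, n * (M i i).re / l i with hc
    have hterm : ∀ i, 0 ≤ n * (M i i).re / l i := fun i => by
      have := (Complex.nonneg_iff.1 (hM.diag_nonneg (i := i))).1
      have := hl0 i
      positivity
    have hdiag : (diagonal fun i => ((c * l i - n * (M i i).re : ℝ) : ℂ)).PosSemidef := by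
      refine Matrix.PosSemidef.diagonal fun i => ?_
      simp only [Pi.zero_apply, Complex.zero_le_real, sub_nonneg]
      rcases eq_or_ne (l i) 0 with h0 | h0
      · simp [h0, h i h0]
      · calc n * (M i i).re = n * (M i i).re / l i * l i := by field_simp
          _ ≤ c * l i := by
            gcongr
            · exact hl0 i
            · exact Finset.single_le_sum (fun j _ => hterm j) (Finset.mem_univ i)
    have key := (hdiag.add hM.pinching).mul_mul_conjTranspose_same U
    convert key using 1
    rw [hBd]
    conv_lhs => rw [hAM]
    rw [← smul_mul_assoc, ← mul_smul_comm, ← sub_mul, ← mul_sub]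
    congr 2
    ext i j
    by_cases hij : i = j
    · subst hij
      have : (M i i) = ((M i i).re : ℂ) :=
        Complex.ext rfl (by simpa using (Complex.nonneg_iff.1 (hM.diag_nonneg (i := i))).2.symm)
      simp only [Matrix.sub_apply, Matrix.smul_apply, diagonal_apply_eq, Matrix.add_apply, smul_eq_mul]
      push_cast
      simp only [← this, n]
      push_cast
      ring
    · simp [hij]

/-! ### Tensor powers -/

/-- The `N`-fold tensor power of a matrix. -/
def matrixTensorPower {s : Type*} (N : ℕ) (A : Matrix s s ℂ) :
    Matrix (Fin N → s) (Fin N → s) ℂ :=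
  Matrix.of fun p q => ∏ n, A (p n) (q n)

/-- Writing the tensor product as a Schur product reduces positivity to the Schur product theorem.
-/
theorem matrixTensorPower_succ {s : Type*} (N : ℕ) (A : Matrix s s ℂ) :
    matrixTensorPower (N + 1) A = (A.submatrix (fun p : Fin (N + 1) → s => p 0) fun p => p 0) ⊙
      (matrixTensorPower N A).submatrix Fin.tail Fin.tail := by
  ext p q
  exact Fin.prod_univ_succ _

theorem matrixTensorPower_smul {s : Type*} (N : ℕ) (c : ℂ) (A : Matrix s s ℂ) :
    matrixTensorPower N (c • A) = c ^ N • matrixTensorPower N A := by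
  ext p q
  simp [matrixTensorPower, Finset.prod_mul_distrib]

theorem matrixTensorPower_one {s : Type*} [DecidableEq s] (N : ℕ) :
    matrixTensorPower N (1 : Matrix s s ℂ) = 1 := by
  ext p q
  simp [matrixTensorPower, Matrix.one_apply, Finset.prod_ite_zero, funext_iff]

theorem posSemidef_matrixTensorPower {s : Type*} [Fintype s] {A : Matrix s s ℂ}
    (hA : A.PosSemidef) (N : ℕ) : (matrixTensorPower N A).PosSemidef := by
  induction N with
  | zero =>
    have : matrixTensorPower 0 A = ketbra 1 := by
      ext p q
      simp [matrixTensorPower, ketbra, vecMulVec_apply]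
    rw [this]
    exact posSemidef_ketbra _
  | succ N ih =>
    rw [matrixTensorPower_succ]
    exact (hA.submatrix _).hadamard (ih.submatrix _)

/-- Telescoping: B ⊗ B' − A ⊗ A' = (B − A) ⊗ B' + A ⊗ (B' − A'), with both summands positive. -/
theorem posSemidef_matrixTensorPower_sub {s : Type*} [Fintype s] {A B : Matrix s s ℂ}
    (hA : A.PosSemidef) (hAB : (B - A).PosSemidef) (N : ℕ) :
    (matrixTensorPower N B - matrixTensorPower N A).PosSemidef := by
  have hB : B.PosSemidef := by simpa using hAB.add hA
  induction N with
  | zero =>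
    have : matrixTensorPower 0 B - matrixTensorPower 0 A = 0 := by
      ext p q
      simp [matrixTensorPower]
    rw [this]
    exact .zero
  | succ N ih =>
    have e : matrixTensorPower (N + 1) B - matrixTensorPower (N + 1) A =
        ((B - A).submatrix (fun p : Fin (N + 1) → s => p 0) fun p => p 0) ⊙
          ((matrixTensorPower N B).submatrix Fin.tail Fin.tail) +
        (A.submatrix (fun p : Fin (N + 1) → s => p 0) fun p => p 0) ⊙
          ((matrixTensorPower N B - matrixTensorPower N A).submatrix Fin.tail Fin.tail) := by
      rw [matrixTensorPower_succ, matrixTensorPower_succ]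
      ext p q
      simp only [Matrix.sub_apply, Matrix.add_apply, hadamard_apply, submatrix_apply]
      ring
    rw [e]
    exact ((hAB.submatrix _).hadamard ((posSemidef_matrixTensorPower hB N).submatrix _)).add
      ((hA.submatrix _).hadamard (ih.submatrix _))

theorem trace_matrixTensorPower {s : Type*} [Fintype s] (N : ℕ) (A : Matrix s s ℂ) :
    (matrixTensorPower N A).trace = A.trace ^ N := by
  exact (Fintype.sum_pow (fun i => A i i) N).symm

theorem matrixTensorPower_mul {s : Type*} [Fintype s] (N : ℕ) (A B : Matrix s s ℂ) :
    matrixTensorPower N A * matrixTensorPower N B = matrixTensorPower N (A * B) := by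
  ext p q
  simp only [Matrix.mul_apply, matrixTensorPower, Matrix.of_apply, ← Finset.prod_mul_distrib]
  exact (Fintype.prod_sum fun n k => A (p n) k * B k (q n)).symm

theorem choi_tensorPower {a b : Type*} [Fintype a] [DecidableEq a] (N : ℕ)
    (Φ : Matrix a a ℂ →ₗ[ℂ] Matrix b b ℂ) :
    choi (tensorPower N Φ) =
      (matrixTensorPower N (choi Φ)).submatrix (fun x n => (x.1 n, x.2 n))
        (fun x n => (x.1 n, x.2 n)) := by
  ext p q
  change ∑ k : Fin N → a, ∑ l : Fin N → a,
    (Matrix.single p.2 q.2 (1 : ℂ)) k l *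
      ∏ n, Φ (Matrix.single (k n) (l n) 1) (p.1 n) (q.1 n) = _
  simp [Matrix.single_apply, ite_and, matrixTensorPower, choi]

theorem trace_tensorPower {a b : Type*} [Fintype a] [DecidableEq a] [Fintype b] (N : ℕ)
    {Φ : Matrix a a ℂ →ₗ[ℂ] Matrix b b ℂ} (htr : ∀ X, (Φ X).trace = X.trace)
    (X : Matrix (Fin N → a) (Fin N → a) ℂ) : (tensorPower N Φ X).trace = X.trace := by
  change ∑ p : Fin N → b, ∑ k : Fin N → a, ∑ l : Fin N → a,
      X k l * ∏ n, Φ (Matrix.single (k n) (l n) 1) (p n) (p n) = ∑ k, X k k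
  rw [Finset.sum_comm]
  refine Finset.sum_congr rfl fun k _ => ?_
  rw [Finset.sum_comm]
  -- The sum over outputs factors into the traces of Φ(|kₙ⟩⟨lₙ|), which are Kronecker deltas.
  have h (l : Fin N → a) : ∑ p : Fin N → b,
      X k l * ∏ n, Φ (Matrix.single (k n) (l n) 1) (p n) (p n) = if k = l then X k l else 0 := by
    rw [← Finset.mul_sum,
      ← Fintype.prod_sum fun n i => Φ (Matrix.single (k n) (l n) 1) i i]
    have : ∀ n, ∑ i, Φ (Matrix.single (k n) (l n) 1) i i = if k n = l n then (1 : ℂ) else 0 := by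
      intro n
      refine (htr _).trans ?_
      by_cases h : k n = l n
      · simp [h, Matrix.trace_single_eq_same]
      · simp [h, Matrix.trace_single_eq_of_ne]
    simp [this, Finset.prod_ite_zero, funext_iff]
  simp [h]

/-! ### Domination excludes certification -/

/-- The Choi matrix of `Φ₀` is bounded by a multiple of the Choi matrix of `Φ₁`. -/
def ChoiDominated {a b : Type*} [DecidableEq a]
    (Φ₀ Φ₁ : Matrix a a ℂ →ₗ[ℂ] Matrix b b ℂ) : Prop :=
  ∃ c : ℝ, 0 ≤ c ∧ ((c : ℂ) • choi Φ₁ - choi Φ₀).PosSemidef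

/-- Tensor powers are monotone on positive matrices, so the Choi matrices of Φ₀^{⊗N} and Φ₁^{⊗N} are
dominated with constant c^N. -/
theorem ChoiDominated.one_le_of_parallelCertifiable {d : ℕ} {b : Type*} [Fintype b] [DecidableEq b]
    {Φ₀ Φ₁ : Matrix (Fin d) (Fin d) ℂ →ₗ[ℂ] Matrix b b ℂ} (h₀ : IsQuantumChannel Φ₀)
    (h₁ : IsQuantumChannel Φ₁) (hd : ChoiDominated Φ₀ Φ₁) {N : ℕ} {ε : ℝ}
    (h : ParallelCertifiable Φ₀ Φ₁ N ε) : 1 ≤ ε := by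
  obtain ⟨c, hc, hdom⟩ := hd
  obtain ⟨-, r, _, _, ψ, Ω, hψ, hΩ, hn, hp⟩ := h
  have hch : ∀ Φ : Matrix (Fin d) (Fin d) ℂ →ₗ[ℂ] Matrix b b ℂ, IsQuantumChannel Φ →
      (choi (tensorPower N Φ)).PosSemidef := fun Φ hΦ => by
    rw [choi_tensorPower]
    exact (posSemidef_matrixTensorPower hΦ.posSemidef_choi N).submatrix _
  have hdiff : (choi ((c : ℂ) ^ N • tensorPower N Φ₁ - tensorPower N Φ₀)).PosSemidef := by
    rw [choi_smul_sub, choi_tensorPower, choi_tensorPower]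
    have := posSemidef_matrixTensorPower_sub h₀.posSemidef_choi hdom N
    rw [matrixTensorPower_smul] at this
    exact this.submatrix _
  have hk := posSemidef_ketbra ψ
  refine le_trans (falsePositive_eq_one_of_dominated (c := (c : ℂ) ^ N) hΩ.1
    (posSemidef_tensorId (hch _ h₀) hk) (posSemidef_tensorId (hch _ h₁) hk) ?_
    (posSemidef_tensorId hdiff hk) hn).ge hp
  rw [trace_tensorId (trace_tensorPower N h₀.tracePreserving), trace_ketbra hψ]

/-- Channels preserve the order, so processing keeps the constant and each use multiplies it by c.
-/
theorem ChoiDominated.one_le_of_adaptiveCertifiable {d : ℕ} {b : Type*} [Fintype b] [DecidableEq b]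
    {Φ₀ Φ₁ : Matrix (Fin d) (Fin d) ℂ →ₗ[ℂ] Matrix b b ℂ} (h₀ : IsQuantumChannel Φ₀)
    (h₁ : IsQuantumChannel Φ₁) (hd : ChoiDominated Φ₀ Φ₁) {N : ℕ} {ε : ℝ}
    (h : AdaptiveCertifiable Φ₀ Φ₁ N ε) : 1 ≤ ε := by
  obtain ⟨c, hc, hdom⟩ := hd
  obtain ⟨-, mem, _, _, ψ, Ξ, Ω, hψ, hΞ, hΩ, hn, hp⟩ := h
  have hdiff : (choi ((c : ℂ) • Φ₁ - Φ₀)).PosSemidef := hdom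
  have hc' : (0 : ℂ) ≤ c := Complex.zero_le_real.2 hc
  have hk := posSemidef_ketbra ψ
  have key : ∀ n ≤ N - 1, (adaptiveOutput Φ₀ ψ Ξ n).PosSemidef ∧
      (adaptiveOutput Φ₁ ψ Ξ n).PosSemidef ∧ (adaptiveOutput Φ₀ ψ Ξ n).trace = 1 ∧
      ((c : ℂ) ^ (n + 1) • adaptiveOutput Φ₁ ψ Ξ n - adaptiveOutput Φ₀ ψ Ξ n).PosSemidef := by
    intro n
    induction n with
    | zero =>
      intro _
      refine ⟨posSemidef_tensorId h₀.posSemidef_choi hk, posSemidef_tensorId h₁.posSemidef_choi hk,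
        ?_, ?_⟩
      · rw [adaptiveOutput, trace_tensorId h₀.tracePreserving, trace_ketbra hψ]
      · rw [zero_add, pow_one]
        exact posSemidef_tensorId hdiff hk
    | succ n ih =>
      intro hn'
      obtain ⟨i₀, i₁, it, id⟩ := ih (by omega)
      have hX := hΞ n (by omega)
      refine ⟨posSemidef_tensorId h₀.posSemidef_choi (hX.posSemidef i₀),
        posSemidef_tensorId h₁.posSemidef_choi (hX.posSemidef i₁), ?_, ?_⟩
      · rw [adaptiveOutput, trace_tensorId h₀.tracePreserving, hX.tracePreserving, it]
      -- With τ the current states, c (Φ₁ ⊗ id)Ξ(c^(n+1) τ₁ − τ₀) and ((c Φ₁ − Φ₀) ⊗ id)Ξ(τ₀) are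
      -- positive; their sum is the difference sought.
      · have := ((posSemidef_tensorId h₁.posSemidef_choi (hX.posSemidef id)).smul hc').add
          (posSemidef_tensorId hdiff (hX.posSemidef i₀))
        rw [tensorId_smul_sub, map_sub, map_smul, map_sub, map_smul, smul_sub, smul_smul,
          sub_add_sub_cancel, ← pow_succ'] at this
        exact this
  obtain ⟨k₀, k₁, kt, kd⟩ := key (N - 1) le_rfl
  exact (falsePositive_eq_one_of_dominated hΩ.1 k₀ k₁ kt kd hn).ge.trans hp

/-! ### A one-use test when domination fails -/

/-- A single use of the channel with input `ψ` yields a test `K` that always accepts `Φ₁` and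
sometimes rejects `Φ₀`. -/
theorem exists_test_of_not_choiDominated {d : ℕ} {b : Type*} [Fintype b] [DecidableEq b]
    {Φ₀ Φ₁ : Matrix (Fin d) (Fin d) ℂ →ₗ[ℂ] Matrix b b ℂ} (h₀ : IsQuantumChannel Φ₀)
    (h₁ : IsQuantumChannel Φ₁) (hd : ¬ ChoiDominated Φ₀ Φ₁) :
    ∃ (ψ : Fin d × Fin d → ℂ) (K : Matrix (b × Fin d) (b × Fin d) ℂ),
      IsPureState ψ ∧ IsEffect K ∧ (K * tensorId (Fin d) Φ₁ (ketbra ψ)).trace = 1 ∧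
      ∃ q : ℝ, 0 ≤ q ∧ q < 1 ∧ (K * tensorId (Fin d) Φ₀ (ketbra ψ)).trace = q := by
  rcases dominated_or_exists_vector h₀.posSemidef_choi h₁.posSemidef_choi with h | ⟨v, hv, hv₁, hv₀⟩
  · exact absurd h hd
  have hd0 : (d : ℝ) ≠ 0 := by
    rintro h
    obtain rfl : d = 0 := by exact_mod_cast h
    simp [IsPureState] at hv
  have hdpos : (0 : ℝ) < d := lt_of_le_of_ne (Nat.cast_nonneg d) hd0.symm
  -- Normalisation of the maximally entangled state, whose image under Φ ⊗ id is the Choi matrix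
  -- divided by d.
  let s : ℝ := (√d)⁻¹
  have hs : s * s = (d : ℝ)⁻¹ := by
    rw [← mul_inv, Real.mul_self_sqrt hdpos.le]
  let ψ : Fin d × Fin d → ℂ := fun x => (s : ℂ) * if x.1 = x.2 then 1 else 0
  have hψ : IsPureState ψ := by
    simp only [IsPureState, ψ, norm_mul, mul_pow, Complex.norm_real, Real.norm_eq_abs, sq_abs,
      Fintype.sum_prod_type]
    rw [pow_two, hs]
    simp [apply_ite norm, ite_pow, hd0]
  have hket : ketbra ψ = ((d : ℂ)⁻¹) • ketbra fun x : Fin d × Fin d => if x.1 = x.2 then 1 else 0 := by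
    have hs' : (s : ℂ) * s = (d : ℂ)⁻¹ := by
      rw [← Complex.ofReal_mul, hs]
      simp
    ext x y
    simp only [ketbra, vecMulVec_apply, Pi.star_apply, Matrix.smul_apply, ψ, smul_eq_mul, ← hs',
      star_mul', RCLike.star_def, Complex.conj_ofReal]
    ring
  have hσ (Φ : Matrix (Fin d) (Fin d) ℂ →ₗ[ℂ] Matrix b b ℂ) :
      tensorId (Fin d) Φ (ketbra ψ) = ((d : ℂ)⁻¹) • choi Φ := by
    rw [hket, map_smul, choi_eq_tensorId]
  have hK : IsEffect (1 - ketbra v) := by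
    refine ⟨?_, by simpa using posSemidef_ketbra v⟩
    have hid : (ketbra v) * (ketbra v) = ketbra v := by
      have h1 : star v ⬝ᵥ v = 1 := by
        have := trace_ketbra hv
        rwa [ketbra, trace_vecMulVec, dotProduct_comm] at this
      rw [ketbra, vecMulVec_mul_vecMulVec, h1]
      simp
    have e : (1 - ketbra v)ᴴ * (1 - ketbra v) = 1 - ketbra v := by
      rw [conjTranspose_sub, conjTranspose_one, (posSemidef_ketbra v).1.eq, sub_mul, one_mul,
        mul_sub, mul_one, hid, sub_self, sub_zero]
    rw [← e]
    exact posSemidef_conjTranspose_mul_self _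
  have htr (Φ : Matrix (Fin d) (Fin d) ℂ →ₗ[ℂ] Matrix b b ℂ) (hΦ : IsQuantumChannel Φ) :
      ((1 - ketbra v) * tensorId (Fin d) Φ (ketbra ψ)).trace =
        1 - (d : ℂ)⁻¹ * (star v ⬝ᵥ (choi Φ *ᵥ v)) := by
    rw [sub_mul, one_mul, trace_sub, trace_tensorId hΦ.tracePreserving, trace_ketbra hψ, hσ,
      mul_smul_comm, trace_smul, trace_mul_comm, trace_mul_ketbra, smul_eq_mul]
  refine ⟨ψ, 1 - ketbra v, hψ, hK, ?_, ?_⟩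
  · rw [htr _ h₁, hv₁, mul_zero, sub_zero]
  · have hpos := hK.1.trace_mul_nonneg
      (posSemidef_tensorId (r := Fin d) h₀.posSemidef_choi (posSemidef_ketbra ψ))
    obtain ⟨hre, him⟩ := Complex.nonneg_iff.1 hpos
    refine ⟨_, hre, ?_, Complex.ext rfl (by simpa using him.symm)⟩
    rw [htr _ h₀, ← Complex.ofReal_natCast, ← Complex.ofReal_inv, Complex.sub_re,
      Complex.re_ofReal_mul, Complex.one_re, sub_lt_self_iff]
    exact mul_pos (inv_pos.2 hdpos) (Complex.pos_iff.1 hv₀).1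

/-! ### Parallel repetition of a test -/

theorem isEffect_matrixTensorPower {s : Type*} [Fintype s] [DecidableEq s] {K : Matrix s s ℂ}
    (hK : IsEffect K) (N : ℕ) : IsEffect (matrixTensorPower N K) := by
  refine ⟨posSemidef_matrixTensorPower hK.1 N, ?_⟩
  rw [← matrixTensorPower_one]
  exact posSemidef_matrixTensorPower_sub hK.1 hK.2 N

theorem IsEffect.submatrix {s t : Type*} [Fintype s] [DecidableEq s] [Fintype t] [DecidableEq t]
    {K : Matrix s s ℂ} (hK : IsEffect K) (e : t ≃ s) : IsEffect (K.submatrix e e) := by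
  refine ⟨hK.1.submatrix e, ?_⟩
  rw [← submatrix_one_equiv e]
  exact hK.2.submatrix e

theorem IsEffect.one_sub {s : Type*} [Fintype s] [DecidableEq s] {K : Matrix s s ℂ}
    (hK : IsEffect K) : IsEffect (1 - K) :=
  ⟨hK.2, by simpa using hK.1⟩

theorem trace_submatrix_mul_submatrix {s t : Type*} [Fintype s] [Fintype t] (A B : Matrix s s ℂ)
    (e : t ≃ s) : (A.submatrix e e * B.submatrix e e).trace = (A * B).trace := by
  rw [submatrix_mul_equiv]
  exact e.sum_comp fun i => (A * B) i i

theorem isPureState_of_trace {s : Type*} [Fintype s] {ψ : s → ℂ} (h : (ketbra ψ).trace = 1) :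
    IsPureState ψ := by
  have : ((∑ i, ‖ψ i‖ ^ 2 : ℝ) : ℂ) = 1 := by
    rw [← h]
    simp [ketbra, Matrix.trace, vecMulVec_apply, Complex.mul_conj, Complex.normSq_eq_norm_sq]
  exact_mod_cast this

/-- Regroups `N` systems and `N` ancillas into `N` pairs. -/
def pairing (N : ℕ) (a r : Type*) : (Fin N → a) × (Fin N → r) ≃ (Fin N → a × r) :=
  (Equiv.arrowProdEquivProdArrow (Fin N) (fun _ => a) fun _ => r).symm

theorem ketbra_prod {a r : Type*} (N : ℕ) (ψ : a × r → ℂ) :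
    ketbra (fun x : (Fin N → a) × (Fin N → r) => ∏ n, ψ (x.1 n, x.2 n)) =
      (matrixTensorPower N (ketbra ψ)).submatrix (pairing N a r) (pairing N a r) := by
  ext x y
  simp [ketbra, vecMulVec_apply, matrixTensorPower, pairing, Finset.prod_mul_distrib,
    Equiv.arrowProdEquivProdArrow]

theorem parallelOutput_prod {a b r : Type*} [Fintype a] [DecidableEq a] (N : ℕ)
    (Φ : Matrix a a ℂ →ₗ[ℂ] Matrix b b ℂ) (ψ : a × r → ℂ) :
    parallelOutput N Φ (fun x : (Fin N → a) × (Fin N → r) => ∏ n, ψ (x.1 n, x.2 n)) =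
      (matrixTensorPower N (tensorId r Φ (ketbra ψ))).submatrix (pairing N b r)
        (pairing N b r) := by
  ext p q
  have h := congrFun (congrFun (tensorPower_prod N Φ fun n =>
    Matrix.of fun i j => ketbra ψ (i, p.2 n) (j, q.2 n)) p.1) q.1
  rw [parallelOutput, ketbra_prod]
  exact h

/-- Declare Φ₁ only when K accepts all copies: the effect 1 − K^{⊗N} gives a false negative 1 − 1^N
= 0 and a false positive q^N. -/
theorem canBeCertifiedInParallel_of_test {a b r : Type} [Fintype a] [DecidableEq a] [Fintype b]
    [DecidableEq b] [Fintype r] [DecidableEq r] {Φ₀ Φ₁ : Matrix a a ℂ →ₗ[ℂ] Matrix b b ℂ}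
    (htr : ∀ X, (Φ₁ X).trace = X.trace) {ψ : a × r → ℂ} {K : Matrix (b × r) (b × r) ℂ}
    (hψ : IsPureState ψ) (hK : IsEffect K) (h₁ : (K * tensorId r Φ₁ (ketbra ψ)).trace = 1)
    {q : ℝ} (hq : 0 ≤ q) (hq1 : q < 1) (h₀ : (K * tensorId r Φ₀ (ketbra ψ)).trace = q) :
    CanBeCertifiedInParallel Φ₀ Φ₁ := by
  intro ε hε
  obtain ⟨n, hn⟩ := exists_pow_lt_of_lt_one hε hq1
  have hpure : IsPureState
      fun x : (Fin (n + 1) → a) × (Fin (n + 1) → r) => ∏ n, ψ (x.1 n, x.2 n) := by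
    apply isPureState_of_trace
    rw [ketbra_prod]
    refine ((pairing (n + 1) a r).sum_comp fun i =>
      matrixTensorPower (n + 1) (ketbra ψ) i i).trans ?_
    exact (trace_matrixTensorPower _ _).trans (by rw [trace_ketbra hψ, one_pow])
  refine ⟨n + 1, Nat.le_add_left 1 n, Fin (n + 1) → r, inferInstance, inferInstance,
    fun x => ∏ n, ψ (x.1 n, x.2 n),
    1 - (matrixTensorPower (n + 1) K).submatrix (pairing _ b r) (pairing _ b r), hpure,
    ((isEffect_matrixTensorPower hK _).submatrix _).one_sub, ?_, ?_⟩
  · rw [falseNegative, sub_mul, one_mul, trace_sub, parallelOutput,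
      trace_tensorId (trace_tensorPower _ htr), trace_ketbra hpure, ← parallelOutput,
      parallelOutput_prod, trace_submatrix_mul_submatrix, matrixTensorPower_mul,
      trace_matrixTensorPower, h₁]
    simp
  · rw [falsePositive, sub_sub_cancel, parallelOutput_prod, trace_submatrix_mul_submatrix,
      matrixTensorPower_mul, trace_matrixTensorPower, h₀, ← Complex.ofReal_pow, Complex.ofReal_re]
    exact (pow_le_pow_of_le_one hq hq1.le n.le_succ).trans hn.le

/-! ### Sequential repetition of a test -/

/-- Perform the test `K` and prepare `ρ₀` when it accepts and `ρ₁` when it rejects. -/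
def measurePrepare {s t : Type*} [Fintype s] [DecidableEq s] (K : Matrix s s ℂ)
    (ρ₀ ρ₁ : Matrix t t ℂ) : Matrix s s ℂ →ₗ[ℂ] Matrix t t ℂ where
  toFun X := (K * X).trace • ρ₀ + ((1 - K) * X).trace • ρ₁
  map_add' X Y := by
    simp only [mul_add, trace_add, add_smul]
    abel
  map_smul' c X := by
    simp [mul_smul]

theorem isQuantumChannel_measurePrepare {s t : Type*} [Fintype s] [DecidableEq s] [Fintype t]
    {K : Matrix s s ℂ} {ρ₀ ρ₁ : Matrix t t ℂ} (hK : IsEffect K) (h₀ : ρ₀.PosSemidef)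
    (h₁ : ρ₁.PosSemidef) (t₀ : ρ₀.trace = 1) (t₁ : ρ₁.trace = 1) :
    IsQuantumChannel (measurePrepare K ρ₀ ρ₁) := by
  refine .of_choi ?_ fun X => ?_
  -- The Choi matrix is ρ₀ ⊗ Kᵀ + ρ₁ ⊗ (1 − K)ᵀ; the transpose comes from Tr(K |k⟩⟨l|) = K l k.
  · have e : choi (measurePrepare K ρ₀ ρ₁) = ρ₀.submatrix Prod.fst Prod.fst ⊙
        Kᵀ.submatrix Prod.snd Prod.snd + ρ₁.submatrix Prod.fst Prod.fst ⊙
        (1 - K)ᵀ.submatrix Prod.snd Prod.snd := by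
      ext p q
      have h (A : Matrix s s ℂ) : (A * Matrix.single p.2 q.2 1).trace = A q.2 p.2 := by
        simp [Matrix.trace_mul_single]
      change ((K * Matrix.single p.2 q.2 1).trace • ρ₀ +
        ((1 - K) * Matrix.single p.2 q.2 1).trace • ρ₁) p.1 q.1 = _
      simp only [h, Matrix.add_apply, Matrix.smul_apply, smul_eq_mul, hadamard_apply,
        submatrix_apply, transpose_apply, mul_comm]
    rw [e]
    exact ((h₀.submatrix _).hadamard (hK.1.transpose.submatrix _)).add
      ((h₁.submatrix _).hadamard (hK.2.transpose.submatrix _))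
  · change ((K * X).trace • ρ₀ + ((1 - K) * X).trace • ρ₁).trace = _
    rw [trace_add, trace_smul, trace_smul, t₀, t₁, sub_mul, one_mul, trace_sub]
    simp

open scoped Kronecker in
/-- The state `ρ` together with a classical flag `j`. -/
def withFlag {a r : Type*} (ρ : Matrix (a × r) (a × r) ℂ) (j : Fin 2) :
    Matrix (a × (r × Fin 2)) (a × (r × Fin 2)) ℂ :=
  (ρ ⊗ₖ Matrix.single j j (1 : ℂ)).submatrix (Equiv.prodAssoc a r (Fin 2)).symm
    (Equiv.prodAssoc a r (Fin 2)).symm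

theorem posSemidef_withFlag {a r : Type*} [Fintype a] [Fintype r]
    {ρ : Matrix (a × r) (a × r) ℂ} (h : ρ.PosSemidef) (j : Fin 2) :
    (withFlag ρ j).PosSemidef := by
  classical
  refine (h.kronecker ?_).submatrix _
  have : Matrix.single j j (1 : ℂ) = ketbra (Pi.single j 1) := by
    ext x y
    simp [ketbra, vecMulVec_apply, Matrix.single_apply, Pi.single_apply, ← ite_and, eq_comm,
      and_comm, apply_ite]
  rw [this]
  exact posSemidef_ketbra _

theorem trace_withFlag {a r : Type*} [Fintype a] [Fintype r] (ρ : Matrix (a × r) (a × r) ℂ)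
    (j : Fin 2) : (withFlag ρ j).trace = ρ.trace := by
  refine ((Equiv.prodAssoc a r (Fin 2)).symm.sum_comp fun i =>
    (kroneckerMap (· * ·) ρ (Matrix.single j j (1 : ℂ))) i i).trans ?_
  exact (trace_kronecker _ _).trans (by simp)

theorem trace_withFlag_mul {a r : Type*} [Fintype a] [Fintype r] (K ρ : Matrix (a × r) (a × r) ℂ)
    (i j : Fin 2) :
    (withFlag K i * withFlag ρ j).trace = if i = j then (K * ρ).trace else 0 := by
  rw [withFlag, withFlag, trace_submatrix_mul_submatrix, ← mul_kronecker_mul, trace_kronecker]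
  by_cases h : i = j
  · subst h; simp
  · simp [h]

theorem isEffect_withFlag {a r : Type*} [Fintype a] [Fintype r] [DecidableEq a] [DecidableEq r]
    {K : Matrix (a × r) (a × r) ℂ} (h : IsEffect K) : IsEffect (withFlag K 0) := by
  refine ⟨posSemidef_withFlag h.1 0, ?_⟩
  have e : 1 - withFlag K 0 = withFlag (1 - K) 0 + withFlag 1 1 := by
    ext ⟨x, y, i⟩ ⟨x', y', j⟩
    fin_cases i <;> fin_cases j <;> simp [withFlag, Matrix.one_apply]
  rw [e]
  exact (posSemidef_withFlag h.2 0).add (posSemidef_withFlag .one 1)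

theorem tensorId_withFlag {a b r : Type*} (Φ : Matrix a a ℂ →ₗ[ℂ] Matrix b b ℂ)
    (ρ : Matrix (a × r) (a × r) ℂ) (j : Fin 2) :
    tensorId (r × Fin 2) Φ (withFlag ρ j) = withFlag (tensorId r Φ ρ) j := by
  ext p q
  have h : (Matrix.of fun i k => withFlag ρ j (i, p.2) (k, q.2)) =
      (Matrix.single j j (1 : ℂ)) p.2.2 q.2.2 •
        Matrix.of fun i k => ρ (i, p.2.1) (k, q.2.1) := by
    ext i k
    exact mul_comm _ _
  change Φ (Matrix.of fun i k => withFlag ρ j (i, p.2) (k, q.2)) p.1 q.1 = _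
  rw [h, map_smul]
  exact mul_comm _ _

theorem ketbra_withFlag {a r : Type*} (ψ : a × r → ℂ) :
    ketbra (fun x : a × (r × Fin 2) => ψ (x.1, x.2.1) * if x.2.2 = 0 then 1 else 0) =
      withFlag (ketbra ψ) 0 := by
  ext ⟨x, y, i⟩ ⟨x', y', j⟩
  fin_cases i <;> fin_cases j <;> simp [withFlag, ketbra, vecMulVec_apply]

/-- Each processing step runs the test and prepares ψ afresh. Flag 0 records that all earlier tests
accepted; the flagged test never accepts flag 1, so a rejection is permanent and acceptance after m
+ 1 uses has probability c^(m+1). -/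
theorem canBeCertifiedAdaptively_of_test {a b r : Type} [Fintype a] [DecidableEq a] [Fintype b]
    [DecidableEq b] [Fintype r] [DecidableEq r] {Φ₀ Φ₁ : Matrix a a ℂ →ₗ[ℂ] Matrix b b ℂ}
    (htr : ∀ X, (Φ₀ X).trace = X.trace) (htr₁ : ∀ X, (Φ₁ X).trace = X.trace)
    {ψ : a × r → ℂ} {K : Matrix (b × r) (b × r) ℂ}
    (hψ : IsPureState ψ) (hK : IsEffect K) (h₁ : (K * tensorId r Φ₁ (ketbra ψ)).trace = 1)
    {q : ℝ} (hq : 0 ≤ q) (hq1 : q < 1) (h₀ : (K * tensorId r Φ₀ (ketbra ψ)).trace = q) :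
    CanBeCertifiedAdaptively Φ₀ Φ₁ := by
  intro ε hε
  obtain ⟨n, hn⟩ := exists_pow_lt_of_lt_one hε hq1
  set ψ' : a × (r × Fin 2) → ℂ := fun x => ψ (x.1, x.2.1) * if x.2.2 = 0 then 1 else 0 with hψ'
  have hket : ketbra ψ' = withFlag (ketbra ψ) 0 := ketbra_withFlag ψ
  let Ξ : ∀ _ : ℕ, Matrix (b × (r × Fin 2)) (b × (r × Fin 2)) ℂ →ₗ[ℂ]
      Matrix (a × (r × Fin 2)) (a × (r × Fin 2)) ℂ := fun _ =>
    measurePrepare (withFlag K 0) (withFlag (ketbra ψ) 0) (withFlag (ketbra ψ) 1)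
  have hpure : IsPureState ψ' := isPureState_of_trace (by rw [hket, trace_withFlag, trace_ketbra hψ])
  have hΞ : ∀ m, IsQuantumChannel (Ξ m) := fun m =>
    isQuantumChannel_measurePrepare (isEffect_withFlag hK)
      (posSemidef_withFlag (posSemidef_ketbra ψ) 0) (posSemidef_withFlag (posSemidef_ketbra ψ) 1)
      (by rw [trace_withFlag, trace_ketbra hψ]) (by rw [trace_withFlag, trace_ketbra hψ])
  have key (Φ : Matrix a a ℂ →ₗ[ℂ] Matrix b b ℂ) (hΦ : ∀ X, (Φ X).trace = X.trace) (c : ℂ)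
      (hc : (K * tensorId r Φ (ketbra ψ)).trace = c) (m : ℕ) :
      (adaptiveOutput (mem := fun _ => r × Fin 2) Φ ψ' Ξ m).trace = 1 ∧
      (withFlag K 0 * adaptiveOutput (mem := fun _ => r × Fin 2) Φ ψ' Ξ m).trace =
        c ^ (m + 1) := by
    induction m with
    | zero =>
      rw [adaptiveOutput, trace_tensorId hΦ, trace_ketbra hpure, hket, tensorId_withFlag,
        trace_withFlag_mul, hc]
      simp
    | succ m ih =>
      obtain ⟨it, iK⟩ := ih
      rw [adaptiveOutput]
      refine ⟨by rw [trace_tensorId hΦ, (hΞ m).tracePreserving, it], ?_⟩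
      have e (X : Matrix (b × (r × Fin 2)) (b × (r × Fin 2)) ℂ) : Ξ m X =
        (withFlag K 0 * X).trace • withFlag (ketbra ψ) 0 +
          ((1 - withFlag K 0) * X).trace • withFlag (ketbra ψ) 1 := rfl
      rw [e, iK, map_add, map_smul, map_smul, tensorId_withFlag, tensorId_withFlag, mul_add,
        mul_smul_comm, mul_smul_comm, trace_add, trace_smul, trace_smul, trace_withFlag_mul,
        trace_withFlag_mul, hc]
      simp [pow_succ]
  refine ⟨n + 1, Nat.le_add_left 1 n, fun _ => r × Fin 2, fun _ => inferInstance,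
    fun _ => inferInstance, ψ', Ξ, 1 - withFlag K 0, hpure, fun m _ => hΞ m,
    (isEffect_withFlag hK).one_sub, ?_, ?_⟩
  · obtain ⟨k1, k2⟩ := key Φ₁ htr₁ 1 h₁ n
    rw [falseNegative, sub_mul, one_mul, trace_sub, Nat.add_sub_cancel, k1, k2]
    simp
  · obtain ⟨-, k2⟩ := key Φ₀ htr q h₀ n
    rw [falsePositive, sub_sub_cancel, Nat.add_sub_cancel, k2, ← Complex.ofReal_pow,
      Complex.ofReal_re]
    exact (pow_le_pow_of_le_one hq hq1.le n.le_succ).trans hn.le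

/-! ### Equivalence of the two schemes -/

theorem canBeCertified_of_not_choiDominated {d d' : ℕ}
    {Φ₀ Φ₁ : Matrix (Fin d) (Fin d) ℂ →ₗ[ℂ] Matrix (Fin d') (Fin d') ℂ}
    (h₀ : IsQuantumChannel Φ₀) (h₁ : IsQuantumChannel Φ₁) (hd : ¬ ChoiDominated Φ₀ Φ₁) :
    CanBeCertifiedInParallel Φ₀ Φ₁ ∧ CanBeCertifiedAdaptively Φ₀ Φ₁ := by
  obtain ⟨ψ, K, hψ, hK, k₁, q, hq, hq1, k₀⟩ := exists_test_of_not_choiDominated h₀ h₁ hd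
  exact ⟨canBeCertifiedInParallel_of_test h₁.tracePreserving hψ hK k₁ hq hq1 k₀,
    canBeCertifiedAdaptively_of_test h₀.tracePreserving h₁.tracePreserving hψ hK k₁ hq hq1 k₀⟩

theorem canBeCertifiedInParallel_of_adaptiveCertifiable {d d' : ℕ}
    {Φ₀ Φ₁ : Matrix (Fin d) (Fin d) ℂ →ₗ[ℂ] Matrix (Fin d') (Fin d') ℂ}
    (h₀ : IsQuantumChannel Φ₀) (h₁ : IsQuantumChannel Φ₁) {N : ℕ} {ε : ℝ} (hε : ε < 1)
    (h : AdaptiveCertifiable Φ₀ Φ₁ N ε) : CanBeCertifiedInParallel Φ₀ Φ₁ :=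
  (canBeCertified_of_not_choiDominated h₀ h₁ fun hd =>
    hε.not_ge (hd.one_le_of_adaptiveCertifiable h₀ h₁ h)).1

theorem canBeCertifiedInParallel_iff_adaptively {d d' : ℕ}
    {Φ₀ Φ₁ : Matrix (Fin d) (Fin d) ℂ →ₗ[ℂ] Matrix (Fin d') (Fin d') ℂ}
    (h₀ : IsQuantumChannel Φ₀) (h₁ : IsQuantumChannel Φ₁) :
    CanBeCertifiedInParallel Φ₀ Φ₁ ↔ CanBeCertifiedAdaptively Φ₀ Φ₁ := by
  constructor
  · intro h
    obtain ⟨N, hN⟩ := h (1 / 2) (by norm_num)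
    exact (canBeCertified_of_not_choiDominated h₀ h₁ fun hd =>
      absurd (hd.one_le_of_parallelCertifiable h₀ h₁ hN) (by norm_num)).2
  · intro h
    obtain ⟨N, hN⟩ := h (1 / 2) (by norm_num)
    exact canBeCertifiedInParallel_of_adaptiveCertifiable h₀ h₁ (by norm_num) hN

/-! ### Kraus overlaps and a lower bound for parallel schemes -/

/-- The map `X ↦ ∑ i, E i * X * (E i)ᴴ` with Kraus operators `E i`. -/
def krausMap {ι a b : Type*} [Fintype ι] [Fintype a] (E : ι → Matrix b a ℂ) :
    Matrix a a ℂ →ₗ[ℂ] Matrix b b ℂ where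
  toFun X := ∑ i, E i * X * (E i)ᴴ
  map_add' X Y := by simp [Finset.sum_add_distrib, Matrix.mul_add, Matrix.add_mul]
  map_smul' c X := by simp [Finset.smul_sum]

theorem mul_ketbra_mul_conjTranspose {a b : Type*} [Fintype a] (E : Matrix b a ℂ) (v : a → ℂ) :
    E * ketbra v * Eᴴ = ketbra (E *ᵥ v) := by
  rw [ketbra, mul_vecMulVec, vecMulVec_mul, ketbra, star_mulVec]

theorem krausMap_ketbra {ι a b : Type*} [Fintype ι] [Fintype a] (E : ι → Matrix b a ℂ)
    (v : a → ℂ) : krausMap E (ketbra v) = ∑ i, ketbra (E i *ᵥ v) :=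
  Finset.sum_congr rfl fun i _ => mul_ketbra_mul_conjTranspose (E i) v

theorem krausMap_single {ι a b : Type*} [Fintype ι] [Fintype a] [DecidableEq a]
    (E : ι → Matrix b a ℂ) (k l : a) (p q : b) :
    krausMap E (Matrix.single k l 1) p q = ∑ i, E i p k * star (E i q l) := by
  change (∑ i, E i * Matrix.single k l (1 : ℂ) * (E i)ᴴ : Matrix b b ℂ) p q = _
  simp [Matrix.sum_apply, Matrix.mul_apply, Matrix.single_apply, ite_and]

theorem isQuantumChannel_krausMap {ι a b : Type*} [Fintype ι] [Fintype a] [DecidableEq a]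
    [Fintype b] {E : ι → Matrix b a ℂ} (h : ∑ i, (E i)ᴴ * E i = 1) :
    IsQuantumChannel (krausMap E) := by
  refine .of_choi ?_ fun X => ?_
  · have e : choi (krausMap E) = ∑ i, ketbra fun x : b × a => E i x.1 x.2 := by
      ext p q
      refine (krausMap_single E p.2 q.2 p.1 q.1).trans ?_
      simp [Matrix.sum_apply, ketbra, vecMulVec_apply]
    rw [e]
    exact posSemidef_sum _ fun i _ => posSemidef_ketbra _
  · change (∑ i, E i * X * (E i)ᴴ).trace = _
    rw [trace_sum]
    conv_rhs => rw [← one_mul X, ← h, Finset.sum_mul, trace_sum]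
    refine Finset.sum_congr rfl fun i _ => ?_
    rw [trace_mul_comm, Matrix.mul_assoc]

/-- The Kraus operator `E (I 0) ⊗ ⋯ ⊗ E (I (N - 1))` of the tensor power. -/
def krausPower {ι a b : Type*} {N : ℕ} (E : ι → Matrix b a ℂ) (I : Fin N → ι) :
    Matrix (Fin N → b) (Fin N → a) ℂ :=
  Matrix.of fun p k => ∏ n, E (I n) (p n) (k n)

/-- `(A ⊗ 1) ψ`. -/
def applyFirst {a b r : Type*} [Fintype a] (A : Matrix b a ℂ) (ψ : a × r → ℂ) : b × r → ℂ :=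
  fun x => (A *ᵥ fun k => ψ (k, x.2)) x.1

theorem parallelOutput_krausMap {ι a b r : Type*} [Fintype ι] [Fintype a] [DecidableEq a]
    (N : ℕ) (E : ι → Matrix b a ℂ) (ψ : (Fin N → a) × r → ℂ) :
    parallelOutput N (krausMap E) ψ =
      ∑ I : Fin N → ι, ketbra (applyFirst (krausPower E I) ψ) := by
  ext p q
  change ∑ k : Fin N → a, ∑ l : Fin N → a, ketbra ψ (k, p.2) (l, q.2) *
    ∏ n, krausMap E (Matrix.single (k n) (l n) 1) (p.1 n) (q.1 n) = _
  simp only [krausMap_single, Fintype.prod_sum, Matrix.sum_apply, ketbra, vecMulVec_apply,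
    Pi.star_apply, applyFirst, krausPower, mulVec, dotProduct, Matrix.of_apply, star_sum, star_mul',
    star_prod, Finset.prod_mul_distrib]
  simp only [Finset.sum_mul_sum]
  simp only [Finset.mul_sum]
  conv_rhs => rw [Finset.sum_comm]
  refine Finset.sum_congr rfl fun k _ => ?_
  conv_rhs => rw [Finset.sum_comm]
  refine Finset.sum_congr rfl fun l _ => Finset.sum_congr rfl fun I _ => ?_
  ring

theorem norm_star_dotProduct_sq_le {s : Type*} [Fintype s] (x y : s → ℂ) :
    ‖star x ⬝ᵥ y‖ ^ 2 ≤ (star x ⬝ᵥ x).re * (star y ⬝ᵥ y).re := by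
  have h (z : s → ℂ) : (star z ⬝ᵥ z).re = ∑ i, ‖z i‖ ^ 2 := by
    simp only [dotProduct, Complex.re_sum]
    refine Finset.sum_congr rfl fun i _ => ?_
    rw [Pi.star_apply, RCLike.star_def, ← Complex.normSq_eq_conj_mul_self,
      Complex.normSq_eq_norm_sq, Complex.ofReal_re]
  rw [h, h]
  calc ‖star x ⬝ᵥ y‖ ^ 2 ≤ (∑ i, ‖x i‖ * ‖y i‖) ^ 2 := by
        gcongr
        refine (norm_sum_le _ _).trans (Finset.sum_le_sum fun i _ => ?_)
        simp
    _ ≤ _ := Finset.sum_mul_sq_le_sq_mul_sq _ _ _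

theorem Matrix.PosSemidef.norm_dotProduct_mulVec_sq_le {s : Type*} [Fintype s]
    {K : Matrix s s ℂ} (hK : K.PosSemidef) (x y : s → ℂ) :
    ‖star x ⬝ᵥ (K *ᵥ y)‖ ^ 2 ≤ (star x ⬝ᵥ (K *ᵥ x)).re * (star y ⬝ᵥ (K *ᵥ y)).re := by
  classical
  obtain ⟨B, rfl⟩ : ∃ B : Matrix s s ℂ, K = Bᴴ * B := by
    open scoped MatrixOrder in
    exact CStarAlgebra.nonneg_iff_eq_star_mul_self.1 hK.nonneg
  have h (x y : s → ℂ) : star x ⬝ᵥ ((Bᴴ * B) *ᵥ y) = star (B *ᵥ x) ⬝ᵥ (B *ᵥ y) := by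
    rw [star_mulVec, ← dotProduct_mulVec, mulVec_mulVec]
  rw [h, h, h]
  exact norm_star_dotProduct_sq_le _ _

/-- Mixtures whose components have a large weighted overlap cannot be told apart without
false negatives and with a small probability of a false positive. -/
theorem one_le_mul_sqrt_falsePositive {ι κ s : Type*} [Fintype ι] [Fintype κ] [Fintype s]
    [DecidableEq s] {e : ι → s → ℂ} {f : κ → s → ℂ} {c : ι → κ → ℂ} {Ω : Matrix s s ℂ}
    (hΩ : IsEffect Ω) (htr : (∑ j, ketbra (f j)).trace = 1)
    (hn : falseNegative Ω (∑ j, ketbra (f j)) = 0)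
    (hc : 1 ≤ ‖∑ i, ∑ j, c i j * (star (e i) ⬝ᵥ f j)‖) :
    1 ≤ (∑ i, ∑ j, ‖c i j‖) * √(falsePositive Ω (∑ i, ketbra (e i))) := by
  -- Zero false negative forces Ω to annihilate every fⱼ, so 1 − Ω fixes it.
  have hΩf (j : κ) : Ω *ᵥ f j = 0 := by
    rw [← hΩ.1.dotProduct_mulVec_zero_iff]
    have h0 : ∑ j, (star (f j) ⬝ᵥ (Ω *ᵥ f j)).re = 0 := by
      rw [← hn, falseNegative, Finset.mul_sum, trace_sum, Complex.re_sum]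
      simp only [trace_mul_ketbra]
    have hnn (j : κ) := Complex.nonneg_iff.1 (hΩ.1.dotProduct_mulVec_nonneg (f j))
    exact Complex.ext ((Finset.sum_eq_zero_iff_of_nonneg fun j _ => (hnn j).1).1 h0 j
      (Finset.mem_univ j)) (hnn j).2.symm
  have hKf (j : κ) : (1 - Ω) *ᵥ f j = f j := by
    rw [sub_mulVec, one_mulVec, hΩf, sub_zero]
  have hKe (i : ι) : (star (e i) ⬝ᵥ ((1 - Ω) *ᵥ e i)).re ≤
      falsePositive Ω (∑ i, ketbra (e i)) := by
    rw [falsePositive, Finset.mul_sum, trace_sum, Complex.re_sum]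
    simp only [trace_mul_ketbra]
    exact Finset.single_le_sum
      (f := fun i => (star (e i) ⬝ᵥ ((1 - Ω) *ᵥ e i)).re)
      (fun j _ => (Complex.nonneg_iff.1 (hΩ.2.dotProduct_mulVec_nonneg (e j))).1)
      (Finset.mem_univ i)
  have hff (j : κ) : (star (f j) ⬝ᵥ f j).re ≤ 1 := by
    have h1 : ∑ j, (star (f j) ⬝ᵥ f j).re = 1 := by
      rw [← Complex.re_sum, ← Complex.one_re, ← htr, trace_sum]
      simp only [ketbra, trace_vecMulVec, dotProduct_comm]
    rw [← h1]
    refine Finset.single_le_sum (f := fun j => (star (f j) ⬝ᵥ f j).re) (fun j _ => ?_)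
      (Finset.mem_univ j)
    have := (Complex.nonneg_iff.1 ((PosSemidef.one (n := s) (R := ℂ)).dotProduct_mulVec_nonneg
      (f j))).1
    rwa [one_mulVec] at this
  -- Cauchy–Schwarz for the form 1 − Ω, applied to ⟨eᵢ, fⱼ⟩ = ⟨eᵢ, (1 − Ω) fⱼ⟩.
  have hef (i : ι) (j : κ) : ‖star (e i) ⬝ᵥ f j‖ ≤ √(falsePositive Ω (∑ i, ketbra (e i))) := by
    apply Real.le_sqrt_of_sq_le
    have := hΩ.2.norm_dotProduct_mulVec_sq_le (e i) (f j)
    rw [hKf] at this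
    have h0 := (Complex.nonneg_iff.1 (hΩ.2.dotProduct_mulVec_nonneg (e i))).1
    calc _ ≤ _ := this
      _ ≤ (star (e i) ⬝ᵥ ((1 - Ω) *ᵥ e i)).re * 1 := by gcongr; exact hff j
      _ ≤ _ := by rw [mul_one]; exact hKe i
  refine hc.trans ?_
  rw [Finset.sum_mul]
  refine (norm_sum_le _ _).trans (Finset.sum_le_sum fun i _ => ?_)
  rw [Finset.sum_mul]
  refine (norm_sum_le _ _).trans (Finset.sum_le_sum fun j _ => ?_)
  rw [norm_mul]
  gcongr
  exact hef i j

/-- Lifts a single-use overlap inequality to N uses, with product weights. -/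
theorem sum_krausPower {ι κ a b : Type*} [Fintype ι] [Fintype κ] [Fintype b]
    (N : ℕ) (E : ι → Matrix b a ℂ) (F : κ → Matrix b a ℂ) (c : ι → κ → ℂ) :
    ∑ I : Fin N → ι, ∑ J : Fin N → κ, (∏ n, c (I n) (J n)) • ((krausPower E I)ᴴ * krausPower F J) =
      matrixTensorPower N (∑ i, ∑ j, c i j • ((E i)ᴴ * F j)) := by
  ext k l
  simp only [matrixTensorPower, Matrix.sum_apply, Matrix.smul_apply, Matrix.mul_apply, krausPower,
    Matrix.of_apply, Matrix.conjTranspose_apply, Fintype.prod_sum, smul_eq_mul, star_prod,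
    Finset.prod_mul_distrib]

theorem star_applyFirst_dotProduct {a b r : Type*} [Fintype a] [Fintype b] [Fintype r]
    (A B : Matrix b a ℂ) (ψ : a × r → ℂ) :
    star (applyFirst A ψ) ⬝ᵥ applyFirst B ψ =
      ∑ s, star (fun k => ψ (k, s)) ⬝ᵥ ((Aᴴ * B) *ᵥ fun k => ψ (k, s)) := by
  rw [dotProduct, Fintype.sum_prod_type_right]
  refine Finset.sum_congr rfl fun s _ => ?_
  rw [← mulVec_mulVec, dotProduct_mulVec, ← star_mulVec]
  rfl

/-- If `1 ≤ ∑ c i j • (E i)ᴴ * F j` then, for any number of parallel uses, the probability of a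
false positive is bounded away from zero. -/
theorem exists_le_of_parallelCertifiable {ι κ a b : Type*} [Fintype ι] [Fintype κ] [Fintype a]
    [DecidableEq a] [Fintype b] [DecidableEq b] {E : ι → Matrix b a ℂ} {F : κ → Matrix b a ℂ}
    (hF : ∑ j, (F j)ᴴ * F j = 1) {c : ι → κ → ℂ}
    (hc : (∑ i, ∑ j, c i j • ((E i)ᴴ * F j) - 1).PosSemidef) (N : ℕ) :
    ∃ δ : ℝ, 0 < δ ∧ ∀ ε, ParallelCertifiable (krausMap E) (krausMap F) N ε → δ ≤ ε := by
  set C : ℝ := ∑ I : Fin N → ι, ∑ J : Fin N → κ, ‖∏ n, c (I n) (J n)‖ with hC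
  -- The overlap bound will give C² ε ≥ 1; the added 1 makes the denominator positive without
  -- discussing C.
  refine ⟨1 / (C ^ 2 + 1), by positivity, fun ε h => ?_⟩
  obtain ⟨-, r, _, _, ψ, Ω, hψ, hΩ, hn, hp⟩ := h
  have htr : (parallelOutput N (krausMap F) ψ).trace = 1 := by
    rw [parallelOutput, trace_tensorId (trace_tensorPower N
      (isQuantumChannel_krausMap hF).tracePreserving), trace_ketbra hψ]
  rw [parallelOutput_krausMap] at hn hp htr
  have hsum : ∑ I : Fin N → ι, ∑ J : Fin N → κ, (∏ n, c (I n) (J n)) *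
      (star (applyFirst (krausPower E I) ψ) ⬝ᵥ applyFirst (krausPower F J) ψ) =
      ∑ s, star (fun k => ψ (k, s)) ⬝ᵥ
        (matrixTensorPower N (∑ i, ∑ j, c i j • ((E i)ᴴ * F j)) *ᵥ fun k => ψ (k, s)) := by
    simp only [← sum_krausPower, star_applyFirst_dotProduct, sum_mulVec, dotProduct_sum,
      smul_mulVec, dotProduct_smul, Finset.mul_sum, smul_eq_mul]
    conv_rhs => rw [Finset.sum_comm]
    refine Finset.sum_congr rfl fun I _ => ?_
    rw [Finset.sum_comm]
  have hone : (1 : ℂ) = ∑ s, star (fun k => ψ (k, s)) ⬝ᵥ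
      ((1 : Matrix (Fin N → a) (Fin N → a) ℂ) *ᵥ fun k => ψ (k, s)) := by
    rw [← trace_ketbra hψ, ketbra, trace_vecMulVec, dotProduct_comm, dotProduct,
      Fintype.sum_prod_type_right]
    simp only [one_mulVec]
    rfl
  -- An operator that is at least 1 has tensor powers that are at least 1, and ψ is a unit vector.
  have hge : 1 ≤ ∑ s, star (fun k => ψ (k, s)) ⬝ᵥ
      (matrixTensorPower N (∑ i, ∑ j, c i j • ((E i)ᴴ * F j)) *ᵥ fun k => ψ (k, s)) := by
    rw [hone]
    refine Finset.sum_le_sum fun s _ => ?_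
    have := (posSemidef_matrixTensorPower_sub .one hc N).dotProduct_mulVec_nonneg
      fun k => ψ (k, s)
    rwa [matrixTensorPower_one, sub_mulVec, dotProduct_sub, sub_nonneg] at this
  have hmain := one_le_mul_sqrt_falsePositive 
    (c := fun (I : Fin N → ι) (J : Fin N → κ) => ∏ n, c (I n) (J n)) hΩ htr hn (by
    rw [hsum]
    exact ((Complex.le_def.1 hge).1.trans (Complex.re_le_norm _)))
  have h1 : 1 ≤ C * √ε := hmain.trans (by gcongr)
  have hε : 0 < ε := by
    by_contra hneg
    rw [Real.sqrt_eq_zero_of_nonpos (not_lt.1 hneg)] at h1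
    linarith [mul_zero C]
  rw [div_le_iff₀ (by positivity)]
  have h2 : 1 ≤ (C * √ε) ^ 2 := one_le_pow₀ h1
  rw [mul_pow, Real.sq_sqrt hε.le] at h2
  linarith

/-! ### The example: a key that must be fed back -/

theorem ketbra_apply {s : Type*} (ψ : s → ℂ) (i j : s) : ketbra ψ i j = ψ i * star (ψ j) := rfl

/-- Kraus operators of the null hypothesis of the example: prepare `|0⟩` on input `|2⟩`, answer `0`
on input `|0⟩`, answer at random on input `|1⟩`. -/
noncomputable def nullKraus : Fin 4 → Matrix (Fin 2) (Fin 3) ℂ :=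
  ![!![0, 0, 1; 0, 0, 0], !![1, 0, 0; 0, 0, 0], !![0, 3 / 5, 0; 0, 0, 0], !![0, 0, 0; 0, 4 / 5, 0]]

/-- Kraus operators of the alternative hypothesis of the example: prepare `|u⟩` on input `|2⟩`,
answer `1` on input `|u⟩` and `0` on the vector orthogonal to it, where
`|u⟩ = 3/5 |0⟩ + 4/5 |1⟩`. -/
noncomputable def alternativeKraus : Fin 3 → Matrix (Fin 2) (Fin 3) ℂ :=
  ![!![0, 0, 3 / 5; 0, 0, 4 / 5], !![0, 0, 0; 3 / 5, 4 / 5, 0], !![4 / 5, -3 / 5, 0; 0, 0, 0]]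

theorem sum_nullKraus : ∑ i, (nullKraus i)ᴴ * nullKraus i = 1 := by
  ext i j
  fin_cases i <;> fin_cases j <;>
    simp [nullKraus, Fin.sum_univ_succ, Matrix.mul_apply, Complex.conj_ofNat]
  norm_num

theorem sum_alternativeKraus : ∑ i, (alternativeKraus i)ᴴ * alternativeKraus i = 1 := by
  ext i j
  fin_cases i <;> fin_cases j <;>
    simp [alternativeKraus, Fin.sum_univ_succ, Matrix.mul_apply, Complex.conj_ofNat] <;> norm_num

/-- Weights for which the weighted sum of the overlaps of the Kraus operators is at least `1`. -/
noncomputable def overlapWeight : Fin 4 → Fin 3 → ℂ :=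
  ![![5 / 3, 0, 0], ![0, 0, 5], ![0, 0, -8], ![0, 7 / 4, 0]]

/-- The weight 5/3 normalises the overlap 3/5 on |2⟩ to 1. The others give the rows (4, −3) and (−3,
4) on the qubit, a Hermitian block with eigenvalues 1 and 7. -/
theorem posSemidef_overlap :
    (∑ i, ∑ j, overlapWeight i j • ((nullKraus i)ᴴ * alternativeKraus j) - 1).PosSemidef := by
  have e : ∑ i, ∑ j, overlapWeight i j • ((nullKraus i)ᴴ * alternativeKraus j) - 1 =
      (3 : ℂ) • ketbra ![1, -1, 0] := by
    ext i j
    fin_cases i <;> fin_cases j <;>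
      simp [nullKraus, alternativeKraus, overlapWeight, Fin.sum_univ_succ, Matrix.mul_apply,
        ketbra_apply, Complex.conj_ofNat] <;> norm_num
  rw [e]
  exact (posSemidef_ketbra _).smul (by norm_num)

/-- The embedding of the qubit spanned by `|0⟩` and `|1⟩`. -/
def qubitEmbedding : Matrix (Fin 3 × Unit) (Fin 2 × Unit) ℂ :=
  Matrix.of fun x y => if x.1.val = y.1.val then 1 else 0

theorem qubitEmbedding_mulVec (v : Fin 2 → ℂ) :
    qubitEmbedding *ᵥ (fun x => v x.1) = fun x => ![v 0, v 1, 0] x.1 := by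
  ext ⟨i, _⟩
  fin_cases i <;> simp [qubitEmbedding, mulVec, dotProduct, Fintype.sum_prod_type]

theorem adaptiveOutput_one_eq_ketbra {ι : Type*} [Fintype ι] {E : ι → Matrix (Fin 2) (Fin 3) ℂ}
    {v w : Fin 2 → ℂ} (hv : krausMap E (ketbra ![0, 0, 1]) = ketbra v)
    (hw : krausMap E (ketbra ![v 0, v 1, 0]) = ketbra w) :
    adaptiveOutput (mem := fun _ => Unit) (krausMap E) (fun x => ![0, 0, 1] x.1)
      (fun _ => krausMap fun _ : Unit => qubitEmbedding) 1 = ketbra fun x => w x.1 := by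
  have h (u : Fin 3 → ℂ) (y : Fin 2 → ℂ) (hu : krausMap E (ketbra u) = ketbra y) :
      tensorId Unit (krausMap E) (ketbra fun x => u x.1) = ketbra fun x => y x.1 := by
    ext p q
    exact congrFun (congrFun hu p.1) q.1
  rw [adaptiveOutput, adaptiveOutput, h _ _ hv, krausMap_ketbra]
  simp only [Finset.univ_unique, Finset.sum_singleton]
  rw [qubitEmbedding_mulVec, h _ _ hw]

theorem krausMap_nullKraus_prepare : krausMap nullKraus (ketbra ![0, 0, 1]) = ketbra ![1, 0] := by
  rw [krausMap_ketbra]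
  ext i j
  fin_cases i <;> fin_cases j <;>
    simp [nullKraus, Fin.sum_univ_succ, ketbra_apply]

theorem krausMap_nullKraus_answer : krausMap nullKraus (ketbra ![1, 0, 0]) = ketbra ![1, 0] := by
  rw [krausMap_ketbra]
  ext i j
  fin_cases i <;> fin_cases j <;>
    simp [nullKraus, Fin.sum_univ_succ, ketbra_apply]

theorem krausMap_alternativeKraus_prepare :
    krausMap alternativeKraus (ketbra ![0, 0, 1]) = ketbra ![3 / 5, 4 / 5] := by
  rw [krausMap_ketbra]
  ext i j
  fin_cases i <;> fin_cases j <;>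
    simp [alternativeKraus, Fin.sum_univ_succ, ketbra_apply]

theorem krausMap_alternativeKraus_answer :
    krausMap alternativeKraus (ketbra ![3 / 5, 4 / 5, 0]) = ketbra ![0, 1] := by
  rw [krausMap_ketbra]
  ext i j
  fin_cases i <;> fin_cases j <;>
    simp [alternativeKraus, Fin.sum_univ_succ, ketbra_apply] <;> norm_num

theorem isQuantumChannel_qubitEmbedding :
    IsQuantumChannel (krausMap fun _ : Unit => qubitEmbedding) := by
  apply isQuantumChannel_krausMap
  ext ⟨i, _⟩ ⟨j, _⟩
  fin_cases i <;> fin_cases j <;>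
    simp [qubitEmbedding, Matrix.mul_apply, Fintype.sum_prod_type, Fin.sum_univ_succ]

/-- In the example two adaptive uses identify the channel without any error. -/
theorem adaptiveCertifiable_two {ε : ℝ} (hε : 0 ≤ ε) :
    AdaptiveCertifiable (krausMap nullKraus) (krausMap alternativeKraus) 2 ε := by
  -- Send |2⟩, feed the output back and measure |0⟩⟨0|. Under Φ₀ the state runs |0⟩, |0⟩; under Φ₁
  -- it runs |u⟩, |1⟩. No memory is needed.
  refine ⟨one_le_two, fun _ => Unit, fun _ => inferInstance, fun _ => inferInstance,
    fun x => ![0, 0, 1] x.1, fun _ => krausMap fun _ : Unit => qubitEmbedding,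
    ketbra fun x => ![1, 0] x.1, ?_, fun _ _ => isQuantumChannel_qubitEmbedding,
    ⟨posSemidef_ketbra _, ?_⟩, ?_, ?_⟩
  · simp [IsPureState, Fintype.sum_prod_type, Fin.sum_univ_succ]
  · have e : (1 - ketbra fun x : Fin 2 × Unit => (![1, 0] : Fin 2 → ℂ) x.1) =
        ketbra fun x : Fin 2 × Unit => (![0, 1] : Fin 2 → ℂ) x.1 := by
      ext ⟨i, _⟩ ⟨j, _⟩
      fin_cases i <;> fin_cases j <;> simp [ketbra_apply]
    rw [e]
    exact posSemidef_ketbra _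
  · rw [adaptiveOutput_one_eq_ketbra krausMap_alternativeKraus_prepare
      krausMap_alternativeKraus_answer, falseNegative, trace_mul_ketbra]
    simp [dotProduct, mulVec, ketbra_apply, Fintype.sum_prod_type]
  · rw [adaptiveOutput_one_eq_ketbra krausMap_nullKraus_prepare krausMap_nullKraus_answer,
      falsePositive, trace_mul_ketbra]
    simpa [sub_mulVec, dotProduct, mulVec, ketbra_apply, Fintype.sum_prod_type]
      using hε

/-! ### Separation of the minimal numbers of uses -/

theorem exists_isMinAdaptiveSteps_lt_isMinParallelSteps :
    ∃ (d d' : ℕ)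
        (Φ₀ Φ₁ : Matrix (Fin d) (Fin d) ℂ →ₗ[ℂ] Matrix (Fin d') (Fin d') ℂ),
      IsQuantumChannel Φ₀ ∧ IsQuantumChannel Φ₁ ∧
        CanBeCertifiedInParallel Φ₀ Φ₁ ∧
        ∃ ε : ℝ, 0 < ε ∧ ∃ N_adaptive N_parallel : ℕ,
          IsMinAdaptiveSteps Φ₀ Φ₁ ε N_adaptive ∧
          IsMinParallelSteps Φ₀ Φ₁ ε N_parallel ∧
          N_adaptive < N_parallel := by
  have h₀ := isQuantumChannel_krausMap sum_nullKraus
  have h₁ := isQuantumChannel_krausMap sum_alternativeKraus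
  have hpar := canBeCertifiedInParallel_of_adaptiveCertifiable h₀ h₁ zero_lt_one
    (adaptiveCertifiable_two le_rfl)
  refine ⟨3, 2, _, _, h₀, h₁, hpar, ?_⟩
  obtain ⟨δ₁, hδ₁, k₁⟩ := exists_le_of_parallelCertifiable sum_alternativeKraus posSemidef_overlap 1
  obtain ⟨δ₂, hδ₂, k₂⟩ := exists_le_of_parallelCertifiable sum_alternativeKraus posSemidef_overlap 2
  -- A level strictly below both lower bounds rules out one and two parallel uses.
  have hε : 0 < min δ₁ δ₂ / 2 := by positivity
  have hε' : min δ₁ δ₂ / 2 < min δ₁ δ₂ := half_lt_self (by positivity)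
  obtain ⟨N, hN, hmin⟩ := WellFounded.has_min Nat.lt_wfRel.wf
    {N | AdaptiveCertifiable (krausMap nullKraus) (krausMap alternativeKraus) N _}
    ⟨2, adaptiveCertifiable_two hε.le⟩
  obtain ⟨M, hM, hmin'⟩ := WellFounded.has_min Nat.lt_wfRel.wf
    {M | ParallelCertifiable (krausMap nullKraus) (krausMap alternativeKraus) M _} (hpar _ hε)
  refine ⟨_, hε, N, M, ⟨hN, fun m hm => not_lt.1 (hmin m hm)⟩,
    ⟨hM, fun m hm => not_lt.1 (hmin' m hm)⟩, ?_⟩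
  have hN2 : N ≤ 2 := not_lt.1 (hmin 2 (adaptiveCertifiable_two hε.le))
  refine hN2.trans_lt (not_le.1 fun hM2 => ?_)
  have hM1 : 1 ≤ M := hM.1
  interval_cases M
  · exact absurd ((k₁ _ hM).trans_lt hε') (min_le_left _ _).not_gt
  · exact absurd ((k₂ _ hM).trans_lt hε') (min_le_right _ _).not_gt

theorem mainTheorem2 :
    (∀ (d d' : ℕ)
        (Φ₀ Φ₁ : Matrix (Fin d) (Fin d) ℂ →ₗ[ℂ] Matrix (Fin d') (Fin d') ℂ),
      IsQuantumChannel Φ₀ → IsQuantumChannel Φ₁ →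
        (CanBeCertifiedInParallel Φ₀ Φ₁ ↔ CanBeCertifiedAdaptively Φ₀ Φ₁) ∧
        (∀ (N : ℕ) (ε : ℝ), ε < 1 → AdaptiveCertifiable Φ₀ Φ₁ N ε →
          CanBeCertifiedInParallel Φ₀ Φ₁)) ∧
    (∃ (d d' : ℕ)
        (Φ₀ Φ₁ : Matrix (Fin d) (Fin d) ℂ →ₗ[ℂ] Matrix (Fin d') (Fin d') ℂ),
      IsQuantumChannel Φ₀ ∧ IsQuantumChannel Φ₁ ∧
        CanBeCertifiedInParallel Φ₀ Φ₁ ∧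
        ∃ ε : ℝ, 0 < ε ∧ ∃ N_adaptive N_parallel : ℕ,
          IsMinAdaptiveSteps Φ₀ Φ₁ ε N_adaptive ∧
          IsMinParallelSteps Φ₀ Φ₁ ε N_parallel ∧
          N_adaptive < N_parallel) :=
  ⟨fun _ _ _ _ h₀ h₁ => ⟨canBeCertifiedInParallel_iff_adaptively h₀ h₁,
    fun _ _ hε h => canBeCertifiedInParallel_of_adaptiveCertifiable h₀ h₁ hε h⟩,
    exists_isMinAdaptiveSteps_lt_isMinParallelSteps⟩
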